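/- Let $\alpha$ be an integer with $\alpha\notin\{0,1,2\}$ and let $$G=G(\alpha)=\langle a,b\,|\, a^{[a,b]}=a^{\alpha},\ b^{[b,a]}=b^{\alpha}\rangle$$ be the Macdonald group, where $[x,y]=x^{-1}y^{-1}xy$ and $x^y=y^{-1}xy$. Let $p$ be a prime factor of $\alpha-1$ and let $J$ be a Sylow $p$-subgroup of $G$. Then there is exactly one homomorphism $\pi:G\to J$ that is the identity on $J$ (the projection of $G$ onto its direct factor $J$). Put $A=\pi(a)$, $B=\pi(b)$ and $C=[A,B]$. Then the centralizers in $J$ of $A$ and $B$ are $$C_J(A)=\langle A\rangle,\qquad C_J(B)=\langle B\rangle,$$ and the normalizers in $J$ of the subgroups $\langle A\rangle$ and $\langle B\rangle$ are $$N_J(\langle A\rangle)=\langle A,C\rangle,\qquad N_J(\langle B\rangle)=\langle B,C\rangle.$$ -/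

import Mathlib

/-- The defining relators of the Macdonald group with parameter `α`, in the free group on
two letters `a = of 0` and `b = of 1`. With `[x, y] = x⁻¹ y⁻¹ x y` and `x ^ y = y⁻¹ x y`, they
say that `a ^ [a, b] = a ^ α` and `b ^ [b, a] = b ^ α`. -/
def macdonaldRels (α : ℤ) : Set (FreeGroup (Fin 2)) :=
  let a : FreeGroup (Fin 2) := FreeGroup.of 0
  let b : FreeGroup (Fin 2) := FreeGroup.of 1
  let c : FreeGroup (Fin 2) := a⁻¹ * b⁻¹ * a * b
  let d : FreeGroup (Fin 2) := b⁻¹ * a⁻¹ * b * a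
  {(c⁻¹ * a * c) * (a ^ α)⁻¹, (d⁻¹ * b * d) * (b ^ α)⁻¹}

/-- The Macdonald group `G(α) = ⟨a, b | a ^ [a, b] = a ^ α, b ^ [b, a] = b ^ α⟩`. -/
abbrev MacdonaldGroup (α : ℤ) : Type := PresentedGroup (macdonaldRels α)

/-- The first generator of `G(α)`. -/
def MacdonaldGroup.genA (α : ℤ) : MacdonaldGroup α := PresentedGroup.of 0

/-- The second generator of `G(α)`. -/
def MacdonaldGroup.genB (α : ℤ) : MacdonaldGroup α := PresentedGroup.of 1

/-- `π : G → J` is a projection onto the subgroup `J`, that is, a homomorphism which is the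
identity on `J`. If `G` is finite nilpotent and `J` is a Sylow `p`-subgroup of `G`, then there is
exactly one such `π`: the projection attached to the decomposition of `G` as the direct product
of `J` and the other Sylow subgroups. -/
def IsProjectionOnto {G : Type*} [Group G] (J : Subgroup G) (π : G →* J) : Prop :=
  ∀ x : J, π (x : G) = x

/-! Let p^m be the exact power of p in α - 1 and let e be `macdonaldExp p m α`. The theorem rests on
two facts about J. Upper bound: A^(p^e) ∈ ⟨B⟩ and B^(p^e) ∈ ⟨A⟩. Lower bound: A^(p^(e+m-1)) ≠ 1, and
likewise for B. Since α^(p^(e-1)) - 1 has p-adic valuation e + m - 1, the lower bound says that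
C^(p^(e-1)) does not commute with A.

Every element of J is A^i C^l B^j and C normalizes ⟨A⟩, so only the B^j normalizing ⟨A⟩ and the C^l
centralizing A matter. If such a B^j had p^e ∤ j, then B^n with n = p^(e-1) would normalize ⟨A⟩. But
[B^n, A] is C^(-n) times a power of B^(p^e), so C^n would lie in ⟨A⟩, a contradiction. If C^l
centralizes A, then p^e ∣ l for the same reason, and C^(p^e) ∈ ⟨A⟩ because A^(p^e) commutes with B.
The symmetry a ↔ b, c ↔ c⁻¹ gives the statements for B.

The upper bound comes from `zpow_eq_zpow`: for s = α^r an explicit power of a is a power of b, hence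
central and killed by α - 1. The same identity makes a and b of finite order with all prime factors
dividing α - 1 (`dvd_sub_one_of_dvd_orderOf`). An induction through central quotients then gives
nilpotency and the normal form (`isGood_of_pow_eq_one`). The lower bound comes from explicit
permutation models (`exists_macdonaldTriple_pow_ne_one`), transported to J by
`pow_ne_one_of_isProjectionOnto`. -/

/-- The defining relations of the Macdonald group for elements `a`, `b` and their commutator `c`. -/
structure MacdonaldTriple {H : Type*} [Group H] (α : ℤ) (a b c : H) : Prop where
  comm : a * b = b * a * c
  conj_left : c⁻¹ * a * c = a ^ α
  conj_right : c * b * c⁻¹ = b ^ α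

/-! ### Word identities from the relations. -/

namespace MacdonaldTriple

/-- The sum `α + α ^ 2 + ⋯ + α ^ n`. -/
def geom (α : ℤ) (n : ℕ) : ℤ := ∑ i ∈ Finset.range n, α ^ (i + 1)

theorem geom_succ (α : ℤ) (n : ℕ) : geom α (n + 1) = geom α n + α ^ (n + 1) := by
  simp [geom, Finset.sum_range_succ]

theorem geom_mul (α : ℤ) (n : ℕ) : geom α n * (α - 1) = α * (α ^ n - 1) := by
  induction n with
  | zero => simp [geom]
  | succ n ih => rw [geom_succ, add_mul, ih]; ring

variable {H : Type*} [Group H] {α : ℤ} {a b c : H}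

/-- This symmetry turns every statement about `a` into one about `b`. -/
theorem swap (h : MacdonaldTriple α a b c) : MacdonaldTriple α b a c⁻¹ where
  comm := by rw [h.comm]; group
  conj_left := by simpa using h.conj_right
  conj_right := by simpa using h.conj_left

theorem map {K : Type*} [Group K] (f : H →* K) (h : MacdonaldTriple α a b c) :
    MacdonaldTriple α (f a) (f b) (f c) where
  comm := by simp only [← map_mul, h.comm]
  conj_left := by simp only [← map_mul, ← map_inv, ← map_zpow, h.conj_left]
  conj_right := by simp only [← map_mul, ← map_inv, ← map_zpow, h.conj_right]

theorem of_zpow_eq (h : MacdonaldTriple α a b c) {β : ℤ} (ha : a ^ α = a ^ β)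
    (hb : b ^ α = b ^ β) : MacdonaldTriple β a b c :=
  ⟨h.comm, h.conj_left.trans ha, h.conj_right.trans hb⟩

theorem comm_eq (h : MacdonaldTriple α a b c) : c = a⁻¹ * b⁻¹ * a * b := by
  have := h.comm
  rw [mul_assoc, mul_assoc, this]; group

theorem zpow_mul_pow (h : MacdonaldTriple α a b c) (x : ℤ) (n : ℕ) :
    a ^ x * c ^ n = c ^ n * a ^ (x * α ^ n) := by
  induction n generalizing x with
  | zero => simp
  | succ n ih =>
    have h1 : a ^ x * c = c * a ^ (x * α) := by
      have : c⁻¹ * a ^ x * c = a ^ (x * α) := by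
        have := conj_zpow (a := c⁻¹) (b := a) (i := x)
        rw [inv_inv] at this
        rw [← this, h.conj_left, ← zpow_mul, mul_comm]
      rw [← this]; group
    rw [pow_succ', ← mul_assoc, h1, mul_assoc, ih, pow_succ', mul_assoc, mul_assoc]

theorem pow_mul_zpow (h : MacdonaldTriple α a b c) (x : ℤ) (n : ℕ) :
    c ^ n * b ^ x = b ^ (x * α ^ n) * c ^ n := by
  have := h.swap.zpow_mul_pow (-x) n
  have := congrArg (·⁻¹) this
  simpa using this

theorem mul_pow_eq (h : MacdonaldTriple α a b c) (n : ℕ) :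
    (a * c) ^ n = c ^ n * a ^ geom α n := by
  induction n with
  | zero => simp [geom]
  | succ n ih =>
    have h1 := h.zpow_mul_pow 1 (n + 1)
    rw [zpow_one, one_mul] at h1
    have h2 : a * c ^ (n + 1) * a ^ (geom α n) = c ^ (n + 1) * a ^ (geom α (n + 1)) := by
      rw [h1, mul_assoc, ← zpow_add, geom_succ, add_comm (geom α n)]
    rw [pow_succ', ih, ← h2, pow_succ' c]
    simp only [mul_assoc]

theorem conj_pow (h : MacdonaldTriple α a b c) (n : ℕ) :
    b⁻¹ * a ^ n * b = c ^ n * a ^ geom α n := by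
  have h1 : b⁻¹ * a * b = a * c := by rw [mul_assoc, h.comm]; group
  have h2 := _root_.conj_pow (a := b⁻¹) (b := a) (i := n)
  rw [inv_inv, h1] at h2
  rw [← h2, h.mul_pow_eq]

theorem conj_pow' (h : MacdonaldTriple α a b c) (n : ℕ) :
    a⁻¹ * b ^ n * a = c⁻¹ ^ n * b ^ geom α n := h.swap.conj_pow n

/-- `[bⁿ, a] = c⁻ⁿ b ^ (α + ⋯ + αⁿ - n αⁿ)`. -/
theorem pow_comm_eq (h : MacdonaldTriple α a b c) (n : ℕ) :
    (b ^ n)⁻¹ * (a⁻¹ * b ^ n * a) = c⁻¹ ^ n * b ^ (geom α n - n * α ^ n) := by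
  have h1 := h.swap.zpow_mul_pow (-n) n
  rw [zpow_neg, zpow_natCast] at h1
  rw [h.conj_pow', ← mul_assoc, h1, mul_assoc, ← zpow_add]
  congr 2; ring

/-- A power of `a` which is also a power of `b`. -/
theorem zpow_eq_zpow (h : MacdonaldTriple α a b c) {r s : ℕ} (hs : (s : ℤ) = α ^ r) :
    a ^ (geom α s - s * α ^ s) = b ^ (-(geom α s - s * α ^ s) * α ^ (s + r)) := by
  set n := s + r with hn
  have hα : α ^ n = s * α ^ s := by rw [hn, pow_add, ← hs, mul_comm]
  have e1 : a ^ s = (c ^ r)⁻¹ * a * c ^ r := by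
    have := h.zpow_mul_pow 1 r
    rw [one_mul, zpow_one, ← hs, zpow_natCast] at this
    rw [mul_assoc, this]; group
  have e2 : c ^ r * b = b ^ s * c ^ r := by
    have := h.pow_mul_zpow 1 r
    rwa [one_mul, zpow_one, ← hs, zpow_natCast] at this
  -- The conjugate of a^s by b is computed twice: directly by `conj_pow`, and by writing a^s as the
  -- conjugate of a by c^r, past which b moves at the cost of becoming b^s.
  have e3 : b⁻¹ * a ^ s * b = (c ^ r)⁻¹ * ((b ^ s)⁻¹ * a * b ^ s) * c ^ r := by
    have e4 : b⁻¹ * (c ^ r)⁻¹ = (c ^ r)⁻¹ * (b ^ s)⁻¹ := by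
      rw [← mul_inv_rev, ← mul_inv_rev, e2]
    rw [e1, show b⁻¹ * ((c ^ r)⁻¹ * a * c ^ r) * b = (b⁻¹ * (c ^ r)⁻¹) * a * (c ^ r * b) by group,
      e2, e4]
    group
  have e5 : (b ^ s)⁻¹ * a * b ^ s = a * b ^ (s * α ^ s - geom α s) * c ^ s := by
    have e6 : (b ^ s)⁻¹ * a = a * (a⁻¹ * b ^ s * a)⁻¹ := by group
    rw [e6, h.conj_pow', mul_inv_rev, ← inv_pow, inv_inv, ← zpow_neg]
    have e7 := h.pow_mul_zpow s s
    rw [zpow_natCast] at e7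
    rw [mul_assoc, mul_assoc, e7, ← mul_assoc (b ^ _), ← zpow_add, mul_assoc]
    congr 3; ring
  have e8 : c ^ n * a ^ geom α s = a * b ^ (s * α ^ s - geom α s) * c ^ n := by
    have := h.conj_pow s
    rw [e3, e5] at this
    have h2 : c ^ r * (c ^ s * a ^ geom α s) = a * b ^ (s * α ^ s - geom α s) * c ^ s * c ^ r := by
      rw [← this]; group
    rw [hn, pow_add c s r, ← mul_assoc _ (c ^ s) (c ^ r), ← h2, ← mul_assoc, ← pow_add, ← pow_add,
      add_comm s r]
  have e9 : b ^ (s * α ^ s - geom α s) * c ^ n = c ^ n * a ^ (geom α s - s * α ^ s) := by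
    have h1 := h.zpow_mul_pow (-1) n
    rw [zpow_neg_one] at h1
    calc _ = a⁻¹ * (a * b ^ (s * α ^ s - geom α s) * c ^ n) := by group
      _ = a⁻¹ * c ^ n * a ^ geom α s := by rw [← e8, mul_assoc]
      _ = _ := by
        rw [h1, mul_assoc, ← zpow_add, hα]; congr 2; ring
  set x := geom α s - s * α ^ s
  have e10 : b ^ (-x) = c ^ n * a ^ x * (c ^ n)⁻¹ := by
    rw [← e9, show s * α ^ s - geom α s = -x by simp [x]]; group
  -- Raising to the power α^n undoes the conjugation by c^n.
  rw [zpow_mul, e10, conj_zpow, ← zpow_mul, ← h.zpow_mul_pow]; group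

theorem zpow_mem_zpowers (h : MacdonaldTriple α a b c) {r s : ℕ} (hs : (s : ℤ) = α ^ r) :
    a ^ (geom α s - s * α ^ s) ∈ Subgroup.zpowers b :=
  ⟨_, (h.zpow_eq_zpow hs).symm⟩

/-- A power of `a` in `⟨b⟩` is annihilated by `α - 1`. -/
theorem zpow_mul_sub_one (h : MacdonaldTriple α a b c) {x : ℤ}
    (hx : a ^ x ∈ Subgroup.zpowers b) : a ^ (x * (α - 1)) = 1 := by
  -- A power of both a and b commutes with c, while conjugation by c raises it to the power α.
  obtain ⟨y, hy⟩ := hx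
  have hb : Commute (a ^ x) b := hy ▸ (Commute.refl b).zpow_left y
  have ha : Commute (a ^ x) a := (Commute.refl a).zpow_left x
  have hc : Commute (a ^ x) c := by
    rw [h.comm_eq]
    exact ((ha.inv_right.mul_right hb.inv_right).mul_right ha).mul_right hb
  have := h.zpow_mul_pow x 1
  rw [pow_one, pow_one, hc.eq] at this
  rw [mul_sub, mul_one, zpow_sub, ← mul_left_cancel this, mul_inv_cancel]

end MacdonaldTriple

-- Geometric sums modulo p k.

universe u

/-- This makes divisibility of geometric sums multiplicative in the length, so induction over the
prime factors applies; divisors of α - 1 still divide α^x - 1. -/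
theorem geom_sum_range_mul (α : ℤ) (x y : ℕ) : ∑ i ∈ Finset.range (x * y), α ^ i =
    (∑ i ∈ Finset.range x, α ^ i) * ∑ i ∈ Finset.range y, (α ^ x) ^ i := by
  induction y with
  | zero => simp
  | succ y ih =>
    rw [Nat.mul_succ, Finset.sum_range_add, ih, Finset.sum_range_succ _ y, mul_add,
      Finset.sum_mul _ _ ((α ^ x) ^ y), add_right_inj]
    exact Finset.sum_congr rfl fun i _ => by rw [pow_add, pow_mul, mul_comm]

theorem dvd_geom_sum_sub_card {d α : ℤ} (h : d ∣ α - 1) (n : ℕ) :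
    d ∣ (∑ i ∈ Finset.range n, α ^ i) - n := by
  have : (∑ i ∈ Finset.range n, α ^ i) - n = ∑ i ∈ Finset.range n, (α ^ i - 1) := by
    simp
  rw [this]
  exact Finset.dvd_sum fun i _ => h.trans (sub_one_dvd_pow_sub_one α i)

/-- The geometric sum of length `k` is divisible by `k` if the prime factors of `k` divide
`α - 1`. -/
theorem natCast_dvd_geom_sum {t : ℤ} (k : ℕ) (hk : ∀ q : ℕ, q.Prime → q ∣ k → (q : ℤ) ∣ t) :
    ∀ α : ℤ, t ∣ α - 1 → (k : ℤ) ∣ ∑ i ∈ Finset.range k, α ^ i := by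
  induction k using Nat.recOnMul with
  | zero => simp
  | one => simp
  | prime q hq =>
    intro α hα
    have := dvd_geom_sum_sub_card ((hk q hq dvd_rfl).trans hα) q
    simpa using this
  | mul x y ihx ihy =>
    intro α hα
    rw [geom_sum_range_mul, Nat.cast_mul]
    exact mul_dvd_mul (ihx (fun q hq h => hk q hq (h.mul_right y)) α hα)
      (ihy (fun q hq h => hk q hq (h.mul_left x)) _ (hα.trans (sub_one_dvd_pow_sub_one α x)))

/-- The geometric sum of length `k` is `k` modulo `p * k`, if `p` and the prime factors of `k`
divide `α - 1`, and `4` divides `α - 1` in case `p = 2`. -/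
theorem geom_sum_eq_mul {t : ℤ} {p : ℕ} (hp : p.Prime) (hpt : (p : ℤ) ∣ t)
    (h4 : p = 2 → (4 : ℤ) ∣ t) (k : ℕ)
    (hk : ∀ q : ℕ, q.Prime → q ∣ k → (q : ℤ) ∣ t) :
    ∀ α : ℤ, t ∣ α - 1 → ∃ u : ℤ, ∑ i ∈ Finset.range k, α ^ i = k * (1 + p * u) := by
  induction k using Nat.recOnMul with
  | zero => exact fun _ _ => ⟨0, by simp⟩
  | one => exact fun _ _ => ⟨0, by simp⟩
  | prime q hq =>
    intro α hα
    suffices h : ((p * q : ℕ) : ℤ) ∣ (∑ i ∈ Finset.range q, α ^ i) - q by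
      obtain ⟨u, hu⟩ := h
      refine ⟨u, ?_⟩
      push_cast at hu
      linear_combination hu
    -- For q = p the sum is needed modulo p²: this is 1 + α ≡ 2 modulo 4 if p = 2, and a fact on odd
    -- lengths otherwise. For q ≠ p both primes divide α - 1 and are coprime.
    rcases eq_or_ne p q with rfl | hne
    · rcases hp.eq_two_or_odd' with rfl | hodd
      · have := (h4 rfl).trans hα
        rw [Finset.sum_range_succ, Finset.sum_range_one]
        rwa [pow_zero, pow_one, Nat.cast_two, show 1 + α - 2 = α - 1 by ring]
      · obtain ⟨b, hb⟩ := hpt.trans hα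
        have := odd_sq_dvd_geom_sum₂_sub (a := (1 : ℤ)) (b := b) hodd
        simp only [one_pow, mul_one] at this
        rw [← hb] at this
        simpa [sq] using this
    · refine dvd_geom_sum_sub_card (Dvd.dvd.trans ?_ hα) q
      have : IsCoprime (p : ℤ) (q : ℤ) :=
        Nat.isCoprime_iff_coprime.2 ((Nat.coprime_primes hp hq).2 hne)
      rw [Nat.cast_mul]
      exact this.mul_dvd hpt (hk q hq dvd_rfl)
  | mul x y ihx ihy =>
    intro α hα
    obtain ⟨u, hu⟩ := ihx (fun q hq h => hk q hq (h.mul_right y)) α hα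
    obtain ⟨v, hv⟩ := ihy (fun q hq h => hk q hq (h.mul_left x)) _
      (hα.trans (sub_one_dvd_pow_sub_one α x))
    refine ⟨u + v + p * u * v, ?_⟩
    rw [geom_sum_range_mul, hu, hv]
    push_cast; ring

namespace MacdonaldTriple

theorem geom_eq (α : ℤ) (n : ℕ) : geom α n = α * ∑ i ∈ Finset.range n, α ^ i := by
  simp [geom, Finset.mul_sum, pow_succ']

theorem geom_sub_dvd {α : ℤ} {p k : ℕ} (hp : p.Prime) (hpt : (p : ℤ) ∣ α - 1)
    (h4 : p = 2 → (4 : ℤ) ∣ α - 1) (hk : ∀ q : ℕ, q.Prime → q ∣ k → (q : ℤ) ∣ α - 1) :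
    ((p * k : ℕ) : ℤ) ∣ geom α k - k := by
  obtain ⟨u, hu⟩ := geom_sum_eq_mul hp hpt h4 k hk α dvd_rfl
  obtain ⟨v, hv⟩ := hpt
  obtain rfl : α = 1 + p * v := by linear_combination hv
  rw [geom_eq, hu]
  refine ⟨v + u + p * u * v, ?_⟩
  push_cast; ring

/-- For p = 2 the quotient of the sum by k can have either parity when 4 ∤ α - 1. Both outcomes
serve `pow_mem_center`: a^k commutes with b in the first and is trivial in the second. -/
theorem geom_dichotomy {α : ℤ} {p k : ℕ} (hp : p.Prime) (hpt : (p : ℤ) ∣ α - 1)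
    (hk : ∀ q : ℕ, q.Prime → q ∣ k → (q : ℤ) ∣ α - 1) :
    ((p * k : ℕ) : ℤ) ∣ geom α k - k ∨ ((p * k : ℕ) : ℤ) ∣ geom α k := by
  by_cases h2 : p = 2
  · subst h2
    obtain ⟨u, hu⟩ := natCast_dvd_geom_sum k hk α dvd_rfl
    rw [geom_eq, hu]
    rcases Int.even_or_odd' (α * u) with ⟨v, hv | hv⟩
    · exact .inr ⟨v, by push_cast; linear_combination (k : ℤ) * hv⟩
    · exact .inl ⟨v, by push_cast; linear_combination (k : ℤ) * hv⟩
  · exact .inl (geom_sub_dvd hp hpt (fun h => (h2 h).elim) hk)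

theorem mul_dvd_pow_sub_one {α : ℤ} {p k : ℕ} (hpt : (p : ℤ) ∣ α - 1)
    (hk : ∀ q : ℕ, q.Prime → q ∣ k → (q : ℤ) ∣ α - 1) :
    ((p * k : ℕ) : ℤ) ∣ α ^ k - 1 := by
  rw [← mul_geom_sum, Nat.cast_mul]
  exact mul_dvd_mul hpt (natCast_dvd_geom_sum k hk α dvd_rfl)

/-! ### Nilpotency and the normal form. -/

theorem mem_center_of_commute {H : Type*} [Group H] {a b x : H}
    (hab : Subgroup.closure {a, b} = ⊤) (ha : Commute x a) (hb : Commute x b) :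
    x ∈ Subgroup.center H := by
  have h1 : Subgroup.closure {a, b} ≤ Subgroup.centralizer {x} := by
    rw [Subgroup.closure_le]
    rintro y (rfl | rfl)
    · exact Subgroup.mem_centralizer_singleton_iff.2 ha.eq.symm
    · exact Subgroup.mem_centralizer_singleton_iff.2 hb.eq.symm
  rw [hab] at h1
  exact Subgroup.mem_center_iff.2 fun y =>
    (Subgroup.mem_centralizer_singleton_iff.1 (h1 (Subgroup.mem_top y)))

/-- `H` is nilpotent and every element is of the form `aⁱ cˡ bʲ`. -/
def IsGood {H : Type*} [Group H] (a b c : H) : Prop :=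
  Group.IsNilpotent H ∧ ∀ x : H, ∃ i l j : ℤ, x = a ^ i * c ^ l * b ^ j

/-- Central extensions preserve nilpotency, and a central factor w^n in a lifted normal form can be
moved next to the letter of which w is a power. -/
theorem IsGood.of_quotient {H : Type u} [Group H] {a b c w : H} (hw : w ∈ Subgroup.center H)
    (hmem : w ∈ Subgroup.zpowers a ∨ w ∈ Subgroup.zpowers b ∨ w ∈ Subgroup.zpowers c)
    (hq : ∀ (K : Type u) [Group K] (f : H →* K), Function.Surjective f → f w = 1 →
      IsGood (f a) (f b) (f c)) : IsGood a b c := by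
  have hle : Subgroup.zpowers w ≤ Subgroup.center H := by simpa using hw
  have hn : (Subgroup.zpowers w).Normal :=
    ⟨fun n hn g => by
      rw [Subgroup.mem_center_iff.1 (hle hn) g, mul_assoc, mul_inv_cancel, mul_one]; exact hn⟩
  obtain ⟨h1, h2⟩ := hq _ (QuotientGroup.mk' (Subgroup.zpowers w))
    (QuotientGroup.mk'_surjective _)
    ((QuotientGroup.eq_one_iff w).2 (Subgroup.mem_zpowers w))
  refine ⟨Subgroup.isNilpotent_of_ker_le_center (QuotientGroup.mk' (Subgroup.zpowers w))
    (by rwa [QuotientGroup.ker_mk']), fun x => ?_⟩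
  obtain ⟨i, l, j, hx⟩ := h2 (QuotientGroup.mk' _ x)
  rw [← map_zpow, ← map_zpow, ← map_zpow, ← map_mul, ← map_mul] at hx
  obtain ⟨n, hn⟩ := QuotientGroup.eq.1 hx.symm
  have hx' : x = a ^ i * c ^ l * b ^ j * w ^ n := by
    simp only at hn
    rw [hn]; group
  have hc : ∀ (m : ℤ) (y : H), y * w ^ m = w ^ m * y := fun m y =>
    Subgroup.mem_center_iff.1 (hle (Subgroup.zpow_mem _ (Subgroup.mem_zpowers w) m)) y
  rcases hmem with ⟨y, rfl⟩ | ⟨y, rfl⟩ | ⟨y, rfl⟩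
  · refine ⟨y * n + i, l, j, ?_⟩
    rw [hx', hc, zpow_add, zpow_mul]; simp only [mul_assoc]
  · refine ⟨i, l, j + y * n, ?_⟩
    rw [hx', zpow_add, zpow_mul]; simp only [mul_assoc]
  · refine ⟨i, l + y * n, j, ?_⟩
    rw [hx', mul_assoc, hc n, zpow_add, zpow_mul]; simp only [mul_assoc]

theorem closure_map_eq_top {H K : Type*} [Group H] [Group K] {a b : H}
    (hab : Subgroup.closure {a, b} = ⊤) (f : H →* K) (hf : Function.Surjective f) :
    Subgroup.closure {f a, f b} = ⊤ := by
  rw [← Set.image_pair, ← MonoidHom.map_closure, hab, Subgroup.map_top_of_surjective f hf]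

variable {H : Type*} [Group H] {α : ℤ} {a b c : H}

theorem pow_mem_center (h : MacdonaldTriple α a b c) (hab : Subgroup.closure {a, b} = ⊤)
    {p k : ℕ} (hp : p.Prime) (hpt : (p : ℤ) ∣ α - 1)
    (hk : ∀ q : ℕ, q.Prime → q ∣ k → (q : ℤ) ∣ α - 1) (ha : a ^ (p * k) = 1) (hc : c ^ k = 1) :
    a ^ k ∈ Subgroup.center H := by
  have key : ∀ x : ℤ, ((p * k : ℕ) : ℤ) ∣ x → a ^ x = 1 := fun x ⟨y, hy⟩ => by
    rw [hy, zpow_mul, zpow_natCast, ha, one_zpow]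
  refine mem_center_of_commute hab ((Commute.refl a).pow_left k) ?_
  have h1 := h.conj_pow k
  rw [hc, one_mul] at h1
  rcases geom_dichotomy hp hpt hk with h2 | h2
  · have h3 := key _ h2
    rw [zpow_sub, zpow_natCast, mul_inv_eq_one] at h3
    rw [h3] at h1
    change a ^ k * b = b * a ^ k
    nth_rewrite 2 [← h1]
    group
  · rw [key _ h2] at h1
    have : a ^ k = 1 := by
      calc a ^ k = b * (b⁻¹ * a ^ k * b) * b⁻¹ := by group
        _ = 1 := by rw [h1]; group
    rw [this]
    exact Commute.one_left b

/-- Induction on M = p k. As α^k ≡ 1 modulo p k, the element c^k is central. Once it is killed a^k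
is central, and then b^k; killing these too leaves the exponent k. The steps are proved in reverse
order. -/
theorem isGood_of_pow_eq_one (α : ℤ) (M : ℕ) (hM : M ≠ 0)
    (hMt : ∀ q : ℕ, q.Prime → q ∣ M → (q : ℤ) ∣ α - 1) :
    ∀ (H : Type u) [Group H] (a b c : H), MacdonaldTriple α a b c →
      Subgroup.closure {a, b} = ⊤ → a ^ M = 1 → b ^ M = 1 → IsGood a b c := by
  induction M using induction_on_primes with
  | zero => exact absurd rfl hM
  | one =>
    intro H _ a b c h hab ha hb
    rw [pow_one] at ha hb
    subst ha hb
    have : ∀ x : H, x = 1 := fun x => by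
      have := Subgroup.mem_top x
      rw [← hab, Set.pair_eq_singleton, Subgroup.closure_singleton_one] at this
      exact Subgroup.mem_bot.1 this
    have : Subsingleton H := ⟨fun x y => (this x).trans (this y).symm⟩
    exact ⟨inferInstance, fun x => ⟨0, 0, 0, Subsingleton.elim _ _⟩⟩
  | prime_mul p k hp ih =>
    have hk : ∀ q : ℕ, q.Prime → q ∣ k → (q : ℤ) ∣ α - 1 := fun q hq h => hMt q hq (h.mul_left p)
    have hpt := hMt p hp (Nat.dvd_mul_right p k)
    have ih' := ih (right_ne_zero_of_mul hM) hk
    have step1 : ∀ (H : Type u) [Group H] (a b c : H), MacdonaldTriple α a b c →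
        Subgroup.closure {a, b} = ⊤ → b ^ (p * k) = 1 → c ^ k = 1 → a ^ k = 1 →
        IsGood a b c := by
      intro H _ a b c h hab hb hc ha
      have hw := h.swap.pow_mem_center (by rwa [Set.pair_comm]) hp hpt hk hb (by simp [hc])
      refine IsGood.of_quotient hw (.inr (.inl (Subgroup.npow_mem_zpowers b k))) ?_
      intro K _ f hf hw
      exact ih' K _ _ _ (h.map f) (closure_map_eq_top hab f hf) (by rw [← map_pow, ha, map_one])
        (by rw [← map_pow, hw])
    have step2 : ∀ (H : Type u) [Group H] (a b c : H), MacdonaldTriple α a b c →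
        Subgroup.closure {a, b} = ⊤ → a ^ (p * k) = 1 → b ^ (p * k) = 1 → c ^ k = 1 →
        IsGood a b c := by
      intro H _ a b c h hab ha hb hc
      have hw := h.pow_mem_center hab hp hpt hk ha hc
      refine IsGood.of_quotient hw (.inl (Subgroup.npow_mem_zpowers a k)) ?_
      intro K _ f hf hw
      exact step1 K _ _ _ (h.map f) (closure_map_eq_top hab f hf) (by rw [← map_pow, hb, map_one])
        (by rw [← map_pow, hc, map_one]) (by rw [← map_pow, hw])
    intro H _ a b c h hab ha hb
    have hpow : ∀ x : H, x ^ (p * k) = 1 → x ^ (α ^ k) = x := by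
      intro x hx
      obtain ⟨y, hy⟩ := mul_dvd_pow_sub_one hpt hk
      rw [show α ^ k = ((p * k : ℕ) : ℤ) * y + 1 by linear_combination hy, zpow_add, zpow_mul,
        zpow_natCast, hx, one_zpow, one_mul, zpow_one]
    have hw : c ^ k ∈ Subgroup.center H := by
      refine mem_center_of_commute hab ?_ ?_
      · have := h.zpow_mul_pow 1 k
        rw [one_mul, hpow a ha, zpow_one] at this
        exact this.symm
      · have := h.pow_mul_zpow 1 k
        rwa [one_mul, hpow b hb, zpow_one] at this
    refine IsGood.of_quotient hw (.inr (.inr (Subgroup.npow_mem_zpowers c k))) ?_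
    intro K _ f hf hw
    exact step2 K _ _ _ (h.map f) (closure_map_eq_top hab f hf) (by rw [← map_pow, ha, map_one])
      (by rw [← map_pow, hb, map_one]) (by rw [← map_pow, hw])

end MacdonaldTriple

/-! ### Finite order of the generators and the primes dividing it. -/

namespace MacdonaldTriple

theorem geom_sub_mul (α : ℤ) (s : ℕ) :
    (geom α s - s * α ^ s) * (α - 1) = α * (α ^ s - 1) - s * α ^ s * (α - 1) := by
  rw [sub_mul, geom_mul]

/-- For every prime `q` not dividing `A (A - 1)` some power `s` of `A` has
`q ∤ A (A ^ s - 1) - s A ^ s (A - 1)`. -/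
theorem exists_pow_not_dvd {A q : ℕ} (hq : q.Prime) (hA : ¬ q ∣ A) (hA1 : ¬ (q : ℤ) ∣ A - 1) :
    ∃ r : ℕ, ¬ (q : ℤ) ∣ A * ((A : ℤ) ^ (A ^ r) - 1) - (A ^ r : ℕ) * A ^ (A ^ r) * (A - 1) := by
  have : Fact q.Prime := ⟨hq⟩
  set x : ZMod q := (A : ZMod q) with hx
  have hx0 : x ≠ 0 := by rwa [hx, Ne, ZMod.natCast_eq_zero_iff]
  have hx1 : x - 1 ≠ 0 := by
    intro h
    apply hA1
    rw [← ZMod.intCast_zmod_eq_zero_iff_dvd]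
    push_cast; exact h
  have hiff : ∀ r : ℕ, (q : ℤ) ∣ A * ((A : ℤ) ^ (A ^ r) - 1) -
      (A ^ r : ℕ) * A ^ (A ^ r) * (A - 1) ↔
      x * (x ^ (A ^ r) - 1) - x ^ r * x ^ (A ^ r) * (x - 1) = 0 := by
    intro r
    rw [← ZMod.intCast_zmod_eq_zero_iff_dvd]
    push_cast; rfl
  simp only [hiff]
  clear_value x
  have hfin : IsOfFinOrder x :=
    isOfFinOrder_iff_pow_eq_one.2 ⟨q - 1, Nat.sub_pos_of_lt hq.one_lt,
      ZMod.pow_card_sub_one_eq_one hx0⟩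
  obtain ⟨d, hd⟩ : ∃ d, d = orderOf x := ⟨_, rfl⟩
  have hd0 : 0 < d := hd ▸ hfin.orderOf_pos
  have hd1 : d ≠ 1 := by
    rw [hd, Ne, orderOf_eq_one_iff]
    intro h; exact hx1 (by rw [h, sub_self])
  have hA0 : 0 < A := Nat.pos_of_ne_zero (by rintro rfl; exact hA (dvd_zero q))
  -- The power x^s with s = A^r depends only on s modulo the order d of x. If A is prime to d, then
  -- r = φ(d) gives s ≡ 1 and the value x(x - 1)(1 - x^r), nonzero because 0 < φ(d) < d.
  by_cases hco : A.Coprime d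
  · refine ⟨d.totient, fun h => ?_⟩
    have h1 : x ^ (A ^ d.totient) = x := by
      have hm : A ^ d.totient ≡ 1 [MOD orderOf x] := by
        rw [← hd]; exact Nat.ModEq.pow_totient hco
      rw [← pow_mod_orderOf, show A ^ d.totient % orderOf x = 1 % orderOf x from hm,
        pow_mod_orderOf, pow_one]
    rw [h1] at h
    have h2 : x * (x - 1) * (1 - x ^ d.totient) = 0 := by linear_combination h
    have h3 : x ^ d.totient = 1 := by
      rcases mul_eq_zero.1 h2 with h3 | h3
      · exact absurd h3 (mul_ne_zero hx0 hx1)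
      · exact (sub_eq_zero.1 h3).symm
    exact absurd (Nat.le_of_dvd (Nat.totient_pos.2 hd0)
      ((dvd_of_eq hd).trans (orderOf_dvd_of_pow_eq_one h3)))
      (not_le.2 (Nat.totient_lt d (by omega)))
  -- Now x^r = 1 and the value is x^s - x. It vanishes only if d ∣ A^d - 1, which a common prime
  -- factor of A and d forbids.
  · refine ⟨d, fun h => ?_⟩
    rw [hd, pow_orderOf_eq_one, ← hd] at h
    obtain ⟨n, hn⟩ : ∃ n, A ^ d = n + 1 := Nat.exists_eq_add_one.2 (pow_pos hA0 d)
    rw [hn, pow_succ] at h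
    have h2 : x * (x ^ n - 1) = 0 := by linear_combination h
    have h3 : d ∣ n := (dvd_of_eq hd).trans <| orderOf_dvd_of_pow_eq_one
      (sub_eq_zero.1 ((mul_eq_zero.1 h2).resolve_left hx0))
    obtain ⟨g, hg, hgA, hgd⟩ := Nat.Prime.not_coprime_iff_dvd.1 hco
    have h4 : g ∣ n + 1 := hn ▸ dvd_pow hgA hd0.ne'
    exact hg.one_lt.ne' (Nat.dvd_one.1 ((Nat.dvd_add_right (hgd.trans h3)).1 h4))

variable {H : Type*} [Group H] {α : ℤ} {a b c : H}

/-- For α = -1 only s = 1 is available in `zpow_eq_zpow`, and there the exponent vanishes; hence a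
separate argument. -/
theorem pow_four_eq_one (h : MacdonaldTriple (-1) a b c) : a ^ 4 = 1 := by
  have hg : geom (-1) 2 = 0 := by simp [geom, Finset.sum_range_succ]
  have h1 := h.conj_pow 2
  rw [hg, zpow_zero, mul_one] at h1
  have h2 := h.pow_mul_zpow 1 2
  rw [one_mul, neg_one_sq, zpow_one] at h2
  have h3 : a ^ 2 = c ^ 2 := by
    calc a ^ 2 = b * (b⁻¹ * a ^ 2 * b) * b⁻¹ := by group
      _ = c ^ 2 := by rw [h1, ← h2]; group
  have h4 := h.zpow_mul_pow (2 : ℕ) 1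
  rw [pow_one, pow_one, zpow_natCast, h3, ← pow_succ, pow_succ', ← h3] at h4
  have h5 : a ^ 2 = (a ^ 2)⁻¹ :=
    (mul_left_cancel h4).trans (by rw [mul_neg_one, zpow_neg, zpow_natCast])
  rw [show 4 = 2 + 2 by rfl, pow_add]
  nth_rewrite 1 [h5]
  exact inv_mul_cancel _

theorem isOfFinOrder (h : MacdonaldTriple α a b c) (h0 : α ≠ 0) (h1 : α ≠ 1) :
    IsOfFinOrder a := by
  by_cases h2 : α = -1
  · subst h2
    exact isOfFinOrder_iff_pow_eq_one.2 ⟨4, by norm_num, h.pow_four_eq_one⟩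
  · have hs : ((α.natAbs ^ 2 : ℕ) : ℤ) = α ^ 2 := by push_cast; exact sq_abs α
    have h3 := h.zpow_mul_sub_one (h.zpow_mem_zpowers hs)
    rw [geom_sub_mul] at h3
    refine isOfFinOrder_iff_zpow_eq_one.2 ⟨_, ?_, h3⟩
    -- Cancelling α from the vanishing exponent exhibits α as a divisor of 1.
    intro h4
    have hs1 : α.natAbs ^ 2 = (α.natAbs ^ 2 - 2) + 2 := by
      have : 2 ≤ α.natAbs := by omega
      have : 2 ^ 2 ≤ α.natAbs ^ 2 := Nat.pow_le_pow_left this 2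
      omega
    rw [hs1, ← hs1] at h4
    set n := α.natAbs ^ 2 - 2
    rw [hs1, pow_add] at h4
    have h5 : α * (α ^ n * (α * (α - (↑(n + 2) : ℤ) * (α - 1)))) = α * 1 := by
      linear_combination h4
    have h6 := mul_left_cancel₀ h0 h5
    have h7 : IsUnit α := IsUnit.of_mul_eq_one (α ^ n * (α - (↑(n + 2) : ℤ) * (α - 1)))
      (by linear_combination h6)
    rcases Int.isUnit_iff.1 h7 with h8 | h8
    · exact h1 h8
    · exact h2 h8

/-- A positive parameter, congruent to `α` modulo a given number, defining the same relations. -/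
theorem exists_natCast (h : MacdonaldTriple α a b c) {n : ℕ} (hn : 0 < n) (ha : a ^ n = 1)
    (hb : b ^ n = 1) : ∃ A : ℕ, 1 < A ∧ (n : ℤ) ∣ A - α ∧ MacdonaldTriple (A : ℤ) a b c := by
  have hA : 2 ≤ α + n * (|α| + 2) := by
    have h1 : |α| + 2 ≤ n * (|α| + 2) :=
      le_mul_of_one_le_left (by positivity) (by exact_mod_cast hn)
    have h2 := neg_abs_le α
    linarith
  refine ⟨(α + n * (|α| + 2)).toNat, by omega, ?_, ?_⟩
  · rw [Int.toNat_of_nonneg (by omega)]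
    exact ⟨|α| + 2, by ring⟩
  · rw [Int.toNat_of_nonneg (by omega)]
    refine h.of_zpow_eq ?_ ?_ <;>
    rw [zpow_add, zpow_mul, zpow_natCast] <;> simp [ha, hb]

/-- If q divided α, conjugation by c would send a^(`orderOf a` / q) to 1. -/
theorem not_dvd_of_dvd_orderOf (h : MacdonaldTriple α a b c) (hfin : IsOfFinOrder a) {q : ℕ}
    (hq : q.Prime) (hqa : q ∣ orderOf a) : ¬ (q : ℤ) ∣ α := by
  rintro ⟨y, hy⟩
  obtain ⟨n, hn⟩ := hqa
  have hpos := hfin.orderOf_pos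
  have h1 := h.zpow_mul_pow n 1
  rw [pow_one, pow_one, hy, show (n : ℤ) * (q * y) = orderOf a * y by rw [hn]; push_cast; ring,
    zpow_natCast, zpow_mul, zpow_natCast, pow_orderOf_eq_one, one_zpow, mul_one] at h1
  have h2 : a ^ n = 1 := by simpa using h1
  have h3 : 0 < n := Nat.pos_of_ne_zero (by rintro rfl; omega)
  have h4 := Nat.le_of_dvd h3 (orderOf_dvd_of_pow_eq_one h2)
  rw [hn] at h4
  have := Nat.mul_le_mul_right n hq.two_le
  omega

theorem dvd_sub_one_of_dvd_orderOf (h : MacdonaldTriple α a b c) (h0 : α ≠ 0) (h1 : α ≠ 1)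
    {q : ℕ} (hq : q.Prime) (hqa : q ∣ orderOf a) : (q : ℤ) ∣ α - 1 := by
  by_contra hqt
  have ha := h.isOfFinOrder h0 h1
  have hb := h.swap.isOfFinOrder h0 h1
  -- A positive parameter makes every A^r a natural number, as `zpow_mem_zpowers` requires of s.
  obtain ⟨A, hA1, hAα, hA⟩ := h.exists_natCast (Nat.mul_pos ha.orderOf_pos hb.orderOf_pos)
    (by rw [pow_mul, pow_orderOf_eq_one, one_pow])
    (by rw [mul_comm, pow_mul, pow_orderOf_eq_one, one_pow])
  have hqA : (q : ℤ) ∣ A - α := by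
    refine Dvd.dvd.trans ?_ hAα
    exact_mod_cast hqa.mul_right _
  have hq0 : ¬ q ∣ A := by
    rw [← Int.natCast_dvd_natCast]
    exact hA.not_dvd_of_dvd_orderOf ha hq hqa
  have hq1 : ¬ (q : ℤ) ∣ A - 1 := fun hd => hqt (by
    have := dvd_sub hd hqA
    rwa [show (A : ℤ) - 1 - (A - α) = α - 1 by ring] at this)
  obtain ⟨r, hr⟩ := exists_pow_not_dvd hq hq0 hq1
  have h3 := hA.zpow_mul_sub_one (hA.zpow_mem_zpowers (r := r) (s := A ^ r) (by push_cast; rfl))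
  rw [geom_sub_mul] at h3
  exact hr ((Int.natCast_dvd_natCast.2 hqa).trans (orderOf_dvd_iff_zpow_eq_one.2 h3))

theorem isGood {H : Type u} [Group H] {a b c : H} (h : MacdonaldTriple α a b c) (h0 : α ≠ 0)
    (h1 : α ≠ 1) (hab : Subgroup.closure {a, b} = ⊤) : IsGood a b c := by
  have ha := (h.isOfFinOrder h0 h1).orderOf_pos
  have hb := (h.swap.isOfFinOrder h0 h1).orderOf_pos
  refine isGood_of_pow_eq_one α (orderOf a * orderOf b) (Nat.mul_pos ha hb).ne' ?_ H a b c h hab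
    (by rw [pow_mul, pow_orderOf_eq_one, one_pow])
    (by rw [mul_comm, pow_mul, pow_orderOf_eq_one, one_pow])
  intro q hq hd
  rcases hq.dvd_mul.1 hd with hd | hd
  · exact h.dvd_sub_one_of_dvd_orderOf h0 h1 hq hd
  · exact h.swap.dvd_sub_one_of_dvd_orderOf h0 h1 hq hd

end MacdonaldTriple

/-! ### Projections onto Sylow subgroups. -/

theorem eq_one_of_pow_eq_one_of_coprime {G : Type*} [Group G] {x : G} {m n : ℕ}
    (hmn : m.Coprime n) (hm : x ^ m = 1) (hn : x ^ n = 1) : x = 1 := by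
  have := Nat.dvd_gcd (orderOf_dvd_of_pow_eq_one hm) (orderOf_dvd_of_pow_eq_one hn)
  rwa [hmn.gcd_eq_one, Nat.dvd_one, orderOf_eq_one_iff] at this

/-- The map is the J-component of the decomposition into Sylow subgroups; an element of J has
trivial components at the other primes. Injectivity on J is enough, since the restriction to J can
then be inverted. -/
theorem exists_monoidHom_sylow_injOn {G : Type*} [Group G] [Finite G] [Group.IsNilpotent G]
    {p : ℕ} [Fact p.Prime] (J : Sylow p G) :
    ∃ f : G →* (J : Subgroup G), ∀ x : (J : Subgroup G), f x = 1 → x = 1 := by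
  have hn : ∀ {q : ℕ} [Fact q.Prime] (P : Sylow q G), P.Normal := fun {q} [_] P =>
    ((Group.isNilpotent_of_finite_tfae (G := G)).out 0 3 rfl rfl).mp inferInstance q inferInstance P
  by_cases hp : p ∣ Nat.card G
  · have hmem : p ∈ (Nat.card G).primeFactors :=
      Nat.mem_primeFactors.2 ⟨Fact.out, hp, Nat.card_pos.ne'⟩
    let e := Sylow.directProductOfNormal hn
    refine ⟨{ toFun := fun x => e.symm x ⟨p, hmem⟩ J
              map_one' := by rw [map_one]; rfl
              map_mul' := fun x y => by rw [map_mul]; rfl }, fun x hx => ?_⟩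
    have hy : e.symm (x : G) = 1 := by
      funext ⟨q, hq⟩
      funext Q
      have : Fact q.Prime := ⟨Nat.prime_of_mem_primeFactors hq⟩
      by_cases hqp : q = p
      · subst hqp
        have := Sylow.unique_of_normal J (hn J)
        obtain rfl : Q = J := Subsingleton.elim _ _
        exact hx
      · obtain ⟨n, hxn⟩ := J.isPGroup' x
        have hxn' : (x : G) ^ p ^ n = 1 := by rw [← Subgroup.coe_pow, hxn, Subgroup.coe_one]
        obtain ⟨k, hk⟩ := Q.isPGroup' (e.symm (x : G) ⟨q, hq⟩ Q)
        refine eq_one_of_pow_eq_one_of_coprime (m := p ^ n) (n := q ^ k) ?_ ?_ hk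
        · exact Nat.Coprime.pow _ _ ((Nat.coprime_primes Fact.out Fact.out).2 (Ne.symm hqp))
        · have := congrFun (congrFun (congrArg e.symm hxn') ⟨q, hq⟩) Q
          rwa [map_pow, map_one] at this
    rw [EmbeddingLike.map_eq_one_iff] at hy
    exact_mod_cast hy
  · refine ⟨1, fun x _ => ?_⟩
    by_contra hx
    refine hp ((Fact.out : p.Prime).dvd_of_dvd_pow (n := 1) ?_)
    rw [pow_one]
    obtain ⟨k, hk⟩ := (IsPGroup.iff_orderOf.1 J.isPGroup') x
    have h1 : k ≠ 0 := by
      rintro rfl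
      rw [pow_zero, orderOf_eq_one_iff] at hk
      exact hx hk
    exact ((dvd_pow_self p h1).trans (hk ▸ orderOf_dvd_natCard x)).trans
      (Subgroup.card_subgroup_dvd_card _)

/-- In a finite nilpotent group, every Sylow subgroup is the image of exactly one projection. -/
theorem existsUnique_isProjectionOnto {G : Type*} [Group G] [Finite G] [Group.IsNilpotent G]
    {p : ℕ} [Fact p.Prime] (J : Sylow p G) :
    ∃! π : G →* (J : Subgroup G), IsProjectionOnto (J : Subgroup G) π := by
  obtain ⟨f, hf⟩ := exists_monoidHom_sylow_injOn J
  have hinj : Function.Injective (f.comp (J : Subgroup G).subtype) := by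
    rw [injective_iff_map_eq_one]; exact hf
  let θ := MulEquiv.ofBijective _ (Finite.injective_iff_bijective.1 hinj)
  have hproj : IsProjectionOnto (J : Subgroup G) (θ.symm.toMonoidHom.comp f) := fun x =>
    θ.symm_apply_eq.2 rfl
  refine ⟨_, hproj, fun π hπ => ?_⟩
  set π' := θ.symm.toMonoidHom.comp f
  have hJ : (J : Subgroup G).Normal :=
    ((Group.isNilpotent_of_finite_tfae (G := G)).out 0 3 rfl rfl).mp inferInstance p inferInstance J
  -- Uniqueness: x^[G:J] lies in J, where all projections agree, and raising to a power prime to |J|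
  -- is injective on J.
  have hxJ : ∀ x : G, x ^ (J : Subgroup G).index ∈ (J : Subgroup G) :=
    Subgroup.pow_index_mem _
  refine MonoidHom.ext fun x => (powCoprime J.card_coprime_index).injective ?_
  simp only [powCoprime_apply, ← map_pow]
  exact (hπ ⟨_, hxJ x⟩).trans (hproj ⟨_, hxJ x⟩).symm

/-! ### Centralizers and normalizers in a p-group. -/

theorem pow_mem_zpowers_zpow {G : Type*} [Group G] {p : ℕ} (hp : p.Prime) {y : G} {n e : ℕ}
    (hy : y ^ p ^ n = 1) {l : ℤ} (hl : ¬ ((p ^ e : ℕ) : ℤ) ∣ l) :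
    y ^ p ^ (e - 1) ∈ Subgroup.zpowers (y ^ l) := by
  obtain ⟨s, -, hs⟩ := (Nat.dvd_prime_pow hp).1
    (Int.natCast_dvd_natCast.1 (Int.gcd_dvd_right (a := l) (b := (p ^ n : ℕ))))
  have hsl : ((p ^ s : ℕ) : ℤ) ∣ l := hs ▸ Int.gcd_dvd_left (a := l) (b := (p ^ n : ℕ))
  have hse : s ≤ e - 1 := by
    by_contra hlt
    exact hl ((Int.natCast_dvd_natCast.2 (pow_dvd_pow p (by omega))).trans hsl)
  have h1 : y ^ p ^ s ∈ Subgroup.zpowers (y ^ l) := by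
    have h2 := Int.gcd_eq_gcd_ab l (p ^ n : ℕ)
    rw [hs] at h2
    refine ⟨Int.gcdA l (p ^ n : ℕ), ?_⟩
    rw [← zpow_natCast y (p ^ s), h2, zpow_add, zpow_mul y (p ^ n : ℕ), zpow_natCast y (p ^ n),
      hy, one_zpow, mul_one, zpow_mul]
  obtain ⟨d, hd⟩ := Nat.exists_eq_add_of_le hse
  rw [hd, pow_add, pow_mul]
  exact Subgroup.pow_mem _ h1 _

namespace MacdonaldTriple

variable {H : Type*} [Group H] {α : ℤ} {a b c : H}

/-- The relation maps ⟨a⟩ into itself under conjugation by c; finiteness upgrades the inclusion to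
an equality. -/
theorem closure_le_normalizer [Finite H] (h : MacdonaldTriple α a b c) :
    Subgroup.closure {a, c} ≤ Subgroup.normalizer (Subgroup.zpowers a : Set H) := by
  rw [Subgroup.closure_le]
  rintro x (rfl | rfl)
  · exact Subgroup.le_normalizer (Subgroup.mem_zpowers x)
  · rw [SetLike.mem_coe, ← inv_mem_iff, Subgroup.mem_normalizer_iff_map_conj_eq]
    refine Subgroup.eq_of_le_of_card_ge ?_ ?_
    · rw [MonoidHom.map_zpowers, Subgroup.zpowers_le]
      have : (MulAut.conj x⁻¹) a = a ^ α := by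
        rw [MulAut.conj_apply, inv_inv, h.conj_left]
      exact ⟨α, this.symm⟩
    · exact (Nat.card_congr ((Subgroup.zpowers a).equivMapOfInjective _
        (MulAut.conj x⁻¹).injective).toEquiv).le

/-- As a^k commutes with b, `conj_pow` reads a^k = c^k a^(`geom α k`). -/
theorem pow_mem_zpowers_of_mem (h : MacdonaldTriple α a b c) {k : ℕ}
    (hk : a ^ k ∈ Subgroup.zpowers b) : c ^ k ∈ Subgroup.zpowers a := by
  obtain ⟨y, hy⟩ := hk
  simp only at hy
  have hb : Commute (a ^ k) b := hy ▸ (Commute.refl b).zpow_left y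
  have h1 := h.conj_pow k
  rw [mul_assoc, hb.eq, inv_mul_cancel_left] at h1
  refine ⟨k - geom α k, ?_⟩
  simp only
  rw [zpow_sub, zpow_natCast, h1, mul_inv_cancel_right]

variable {p e : ℕ}

theorem zpow_mem_of_mem_normalizer (h : MacdonaldTriple α a b c) (hp : p.Prime)
    (hH : IsPGroup p H) (hpt : (p : ℤ) ∣ α - 1) (hb : b ^ p ^ e ∈ Subgroup.zpowers a)
    (he : e ≠ 0) (hgeom : ((p ^ e : ℕ) : ℤ) ∣ geom α (p ^ (e - 1)) - (p ^ (e - 1) : ℕ))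
    (hne : a ^ (α ^ p ^ (e - 1)) ≠ a) {j : ℤ}
    (hj : b ^ j ∈ Subgroup.normalizer (Subgroup.zpowers a : Set H)) :
    b ^ j ∈ Subgroup.zpowers a := by
  by_cases hd : ((p ^ e : ℕ) : ℤ) ∣ j
  · obtain ⟨y, rfl⟩ := hd
    rw [zpow_mul, zpow_natCast]
    exact Subgroup.zpow_mem _ hb y
  · exfalso
    obtain ⟨n, hn⟩ := hH b
    have h1 : b ^ p ^ (e - 1) ∈ Subgroup.normalizer (Subgroup.zpowers a : Set H) :=
      (Subgroup.zpowers_le.2 hj) (pow_mem_zpowers_zpow hp hn hd)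
    have h2 := h.pow_comm_eq (p ^ (e - 1))
    have h3 : (b ^ p ^ (e - 1))⁻¹ * (a⁻¹ * b ^ p ^ (e - 1) * a) ∈ Subgroup.zpowers a := by
      rw [← mul_assoc, ← mul_assoc]
      exact mul_mem ((Subgroup.mem_normalizer_iff''.1 h1 a⁻¹).1 (inv_mem (Subgroup.mem_zpowers a)))
        (Subgroup.mem_zpowers a)
    -- With n = p^(e-1), this exponent of b in [b^n, a] is divisible by p^e, so that factor lies in
    -- ⟨a⟩. Then c^n lies in ⟨a⟩ and commutes with a, against `hne`.
    have h4 : ((p ^ e : ℕ) : ℤ) ∣ geom α (p ^ (e - 1)) - (p ^ (e - 1) : ℕ) * α ^ p ^ (e - 1) := by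
      have h5 : ((p ^ e : ℕ) : ℤ) ∣ (p ^ (e - 1) : ℕ) * (α ^ p ^ (e - 1) - 1) := by
        rw [← Nat.sub_add_cancel (Nat.one_le_iff_ne_zero.2 he), pow_succ, Nat.cast_mul,
          Nat.add_sub_cancel]
        exact mul_dvd_mul_left _ (hpt.trans (sub_one_dvd_pow_sub_one α _))
      have := dvd_sub hgeom h5
      rwa [show ∀ x y z : ℤ, x - y - y * (z - 1) = x - y * z by intros; ring] at this
    obtain ⟨y, hy⟩ := h4
    rw [h2, hy, zpow_mul, zpow_natCast] at h3
    have h6 := (Subgroup.mul_mem_cancel_right _ (Subgroup.zpow_mem _ hb y)).1 h3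
    rw [inv_pow, inv_mem_iff] at h6
    obtain ⟨z, hz⟩ := h6
    simp only at hz
    have h7 := h.zpow_mul_pow 1 (p ^ (e - 1))
    rw [one_mul, zpow_one, ← hz, ((Commute.refl a).zpow_right z).eq] at h7
    exact hne (mul_left_cancel h7).symm

theorem exists_of_mem_normalizer [Finite H] (h : MacdonaldTriple α a b c) (hp : p.Prime)
    (hgood : ∀ x : H, ∃ i l j : ℤ, x = a ^ i * c ^ l * b ^ j)
    (hH : IsPGroup p H) (hpt : (p : ℤ) ∣ α - 1) (hb : b ^ p ^ e ∈ Subgroup.zpowers a)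
    (he : e ≠ 0) (hgeom : ((p ^ e : ℕ) : ℤ) ∣ geom α (p ^ (e - 1)) - (p ^ (e - 1) : ℕ))
    (hne : a ^ (α ^ p ^ (e - 1)) ≠ a) {x : H}
    (hx : x ∈ Subgroup.normalizer (Subgroup.zpowers a : Set H)) :
    ∃ i l j : ℤ, x = a ^ i * c ^ l * a ^ j := by
  obtain ⟨i, l, j, rfl⟩ := hgood x
  have h1 : a ^ i * c ^ l ∈ Subgroup.normalizer (Subgroup.zpowers a : Set H) :=
    h.closure_le_normalizer (mul_mem (Subgroup.zpow_mem _ (Subgroup.subset_closure (by simp)) i)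
      (Subgroup.zpow_mem _ (Subgroup.subset_closure (by simp)) l))
  obtain ⟨y, hy⟩ := h.zpow_mem_of_mem_normalizer hp hH hpt hb he hgeom hne
    ((Subgroup.mul_mem_cancel_left _ h1).1 hx)
  exact ⟨i, l, y, by rw [← hy]⟩

theorem normalizer_zpowers_eq [Finite H] (h : MacdonaldTriple α a b c) (hp : p.Prime)
    (hgood : ∀ x : H, ∃ i l j : ℤ, x = a ^ i * c ^ l * b ^ j)
    (hH : IsPGroup p H) (hpt : (p : ℤ) ∣ α - 1) (hb : b ^ p ^ e ∈ Subgroup.zpowers a)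
    (he : e ≠ 0) (hgeom : ((p ^ e : ℕ) : ℤ) ∣ geom α (p ^ (e - 1)) - (p ^ (e - 1) : ℕ))
    (hne : a ^ (α ^ p ^ (e - 1)) ≠ a) :
    Subgroup.normalizer (Subgroup.zpowers a : Set H) = Subgroup.closure {a, c} := by
  refine le_antisymm (fun x hx => ?_) h.closure_le_normalizer
  obtain ⟨i, l, j, rfl⟩ := h.exists_of_mem_normalizer hp hgood hH hpt hb he hgeom hne hx
  have ha : a ∈ Subgroup.closure {a, c} := Subgroup.subset_closure (by simp)
  have hc : c ∈ Subgroup.closure {a, c} := Subgroup.subset_closure (by simp)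
  exact mul_mem (mul_mem (zpow_mem ha i) (zpow_mem hc l)) (zpow_mem ha j)

theorem centralizer_eq_zpowers [Finite H] (h : MacdonaldTriple α a b c) (hp : p.Prime)
    (hgood : ∀ x : H, ∃ i l j : ℤ, x = a ^ i * c ^ l * b ^ j)
    (hH : IsPGroup p H) (hpt : (p : ℤ) ∣ α - 1) (ha : a ^ p ^ e ∈ Subgroup.zpowers b)
    (hb : b ^ p ^ e ∈ Subgroup.zpowers a)
    (he : e ≠ 0) (hgeom : ((p ^ e : ℕ) : ℤ) ∣ geom α (p ^ (e - 1)) - (p ^ (e - 1) : ℕ))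
    (hne : a ^ (α ^ p ^ (e - 1)) ≠ a) :
    Subgroup.centralizer {a} = Subgroup.zpowers a := by
  refine le_antisymm (fun x hx => ?_) ?_
  · have hcent : Subgroup.centralizer {a} ≤ Subgroup.normalizer (Subgroup.zpowers a : Set H) := by
      intro y hy
      rw [Subgroup.mem_normalizer_iff]
      intro z
      have hza : ∀ i : ℤ, y * a ^ i * y⁻¹ = a ^ i := fun i => by
        have h1 : Commute y a := (Subgroup.mem_centralizer_singleton_iff.1 hy)
        rw [(h1.zpow_right i).eq, mul_inv_cancel_right]
      constructor
      · rintro ⟨i, rfl⟩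
        exact ⟨i, (hza i).symm⟩
      · rintro ⟨i, hi⟩
        refine ⟨i, ?_⟩
        simp only at hi ⊢
        rw [← hza i] at hi
        exact mul_left_cancel (mul_right_cancel hi)
    obtain ⟨i, l, j, rfl⟩ := h.exists_of_mem_normalizer hp hgood hH hpt hb he hgeom hne (hcent hx)
    have haa : ∀ i : ℤ, a ^ i ∈ Subgroup.centralizer {a} := fun i =>
      Subgroup.mem_centralizer_singleton_iff.2 ((Commute.refl a).zpow_left i).eq
    have hcl : c ^ l ∈ Subgroup.centralizer {a} :=
      (Subgroup.mul_mem_cancel_left _ (haa i)).1 ((Subgroup.mul_mem_cancel_right _ (haa j)).1 hx)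
    refine mul_mem (mul_mem ⟨i, rfl⟩ ?_) ⟨j, rfl⟩
    by_cases hd : ((p ^ e : ℕ) : ℤ) ∣ l
    · obtain ⟨y, rfl⟩ := hd
      rw [zpow_mul, zpow_natCast]
      exact Subgroup.zpow_mem _ (h.pow_mem_zpowers_of_mem ha) y
    · exfalso
      obtain ⟨n, hn⟩ := hH c
      have h1 : c ^ p ^ (e - 1) ∈ Subgroup.centralizer {a} :=
        (Subgroup.zpowers_le.2 hcl) (pow_mem_zpowers_zpow hp hn hd)
      have h7 := h.zpow_mul_pow 1 (p ^ (e - 1))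
      rw [one_mul, zpow_one, ← Subgroup.mem_centralizer_singleton_iff.1 h1] at h7
      exact hne (mul_left_cancel h7).symm
  · rw [Subgroup.zpowers_le]
    exact Subgroup.mem_centralizer_singleton_iff.2 rfl

end MacdonaldTriple

/-! ### Upper bound: p-adic valuation of the exponent in `zpow_eq_zpow`. -/

theorem exists_one_add_pow_expansion (t : ℤ) (n : ℕ) : ∃ Y : ℤ, 24 * (1 + t) ^ n =
    24 + 24 * n * t + 12 * (n * (n - 1)) * t ^ 2 + 4 * (n * (n - 1) * (n - 2)) * t ^ 3 +
      n * (n - 1) * (n - 2) * (n - 3) * t ^ 4 + t ^ 5 * Y := by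
  induction n with
  | zero => exact ⟨0, by simp⟩
  | succ n ih =>
    obtain ⟨Y, hY⟩ := ih
    refine ⟨Y * (1 + t) + n * (n - 1) * (n - 2) * (n - 3), ?_⟩
    rw [pow_succ]
    push_cast
    linear_combination (1 + t) * hY

/-- This is (1 + t)^(1 + t) (1 - t) = 1 - t³/2 - t⁴/6 + ⋯ with the denominators cleared by 24. -/
theorem exists_self_pow_expansion {A : ℕ} {t : ℤ} (hA : (A : ℤ) = 1 + t) :
    ∃ Z : ℤ, 24 * ((A : ℤ) ^ A * (1 - t) - 1) = -12 * t ^ 3 - 4 * t ^ 4 + t ^ 5 * Z := by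
  obtain ⟨Y, hY⟩ := exists_one_add_pow_expansion t A
  rw [← hA] at hY
  refine ⟨Y * (1 - t) - 8 + (t ^ 3 - 2 * t ^ 2 + 3 * t + 2) * (1 - t), ?_⟩
  have h2 : (24 : ℤ) * ((A : ℤ) ^ A * (1 - t) - 1) = (24 * (A : ℤ) ^ A) * (1 - t) - 24 := by ring
  rw [h2, hY, hA]
  ring

/-- The exponent `e` such that `p ^ e` is the index of the intersection of `⟨a⟩` and `⟨b⟩` in
`⟨a⟩`, for the Sylow `p`-subgroup of the Macdonald group, where `p ^ m` exactly divides `α - 1`. -/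
def macdonaldExp (p m : ℕ) (α : ℤ) : ℕ :=
  if p = 2 then 2 * m - 1 else if p = 3 ∧ α % 9 = 7 then 3 else 2 * m

theorem pow_dvd_of_dvd_expansion {p m k : ℕ} {t u Z X : ℤ} (hp : p ≠ 0) (ht : t = p ^ m * u)
    (hX : 24 * X = -12 * t ^ 3 - 4 * t ^ 4 + t ^ 5 * Z) (hdvd : (p : ℤ) ^ (3 * m + k) ∣ 24 * X)
    (h4 : (p : ℤ) ^ (3 * m + k) ∣ 4 * (p : ℤ) ^ (4 * m)) (h5 : k ≤ 2 * m) :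
    (p : ℤ) ^ k ∣ 12 * u ^ 3 := by
  have hp' : (p : ℤ) ^ (3 * m) ≠ 0 := by positivity
  have h6 : (p : ℤ) ^ (3 * m + k) ∣ (p : ℤ) ^ (5 * m) := pow_dvd_pow _ (by omega)
  have h7 : (p : ℤ) ^ (3 * m) * p ^ k ∣ (p : ℤ) ^ (3 * m) * (12 * u ^ 3) := by
    rw [← pow_add]
    have h8 : (p : ℤ) ^ (3 * m) * (12 * u ^ 3) = p ^ (5 * m) * (u ^ 5 * Z)
        - 4 * p ^ (4 * m) * u ^ 4 - 24 * X := by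
      rw [hX, ht]; ring
    rw [h8]
    exact dvd_sub (dvd_sub (h6.mul_right _) (h4.mul_right _)) hdvd
  exact (mul_dvd_mul_iff_left hp').1 h7

/-- The term t³/2 decides, with valuation 3m, or 3m - 1 if p = 2. For p = 3 and m = 1 the term t⁴/6
also has valuation 3, and the two cancel further exactly when A ≡ 7 modulo 9. -/
theorem not_pow_dvd_self_pow {A p m : ℕ} (hp : p.Prime) (hm : m ≠ 0) {u : ℤ}
    (hA : (A : ℤ) = 1 + p ^ m * u) (hu : ¬ (p : ℤ) ∣ u)
    (h7 : ¬ (p = 3 ∧ (A : ℤ) % 9 = 7)) :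
    ¬ (p : ℤ) ^ (macdonaldExp p m A + m + 1) ∣ (A : ℤ) ^ A * (1 - p ^ m * u) - 1 := by
  intro hdvd
  obtain ⟨Z, hZ⟩ := exists_self_pow_expansion hA
  have hpi : Prime (p : ℤ) := Nat.prime_iff_prime_int.1 hp
  have hu3 : ¬ (p : ℤ) ∣ u ^ 3 := fun h => hu (hpi.dvd_of_dvd_pow h)
  unfold macdonaldExp at hdvd
  split_ifs at hdvd with h2
  · subst h2
    push_cast at *
    rcases Nat.lt_or_ge 1 m with h1 | h1
    · have h8 : (2 : ℤ) ^ (3 * m + 3) ∣ 24 * ((A : ℤ) ^ A * (1 - 2 ^ m * u) - 1) := by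
        rw [show 3 * m + 3 = 3 + (2 * m - 1 + m + 1) by omega, pow_add]
        exact mul_dvd_mul (by norm_num) hdvd
      have h9 := pow_dvd_of_dvd_expansion (p := 2) (by norm_num) rfl hZ (by exact_mod_cast h8)
        (by
          rw [show 3 * m + 3 = 2 + (3 * m + 1) by omega, pow_add]
          exact mul_dvd_mul (by norm_num) (pow_dvd_pow _ (by omega))) (by omega)
      push_cast at h9
      omega
    -- Here the remainder in t⁵ is not negligible. Instead A is odd, so A² ≡ 1 and A^A ≡ A modulo 8.
    · obtain rfl : m = 1 := by omega
      norm_num at hdvd hA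
      obtain ⟨v, hv⟩ : ∃ v : ℕ, A = 2 * v + 1 := ⟨A / 2, by omega⟩
      have h10 : (8 : ℤ) ∣ (A : ℤ) ^ (2 * v) - 1 := by
        have h11 : (8 : ℤ) ∣ (A : ℤ) ^ 2 - 1 := by
          rw [Int.dvd_iff_emod_eq_zero]
          have : (A : ℤ) % 8 = 1 ∨ (A : ℤ) % 8 = 3 ∨ (A : ℤ) % 8 = 5 ∨ (A : ℤ) % 8 = 7 := by omega
          rcases this with h | h | h | h <;> simp [sq, Int.sub_emod, Int.mul_emod, h]
        rw [pow_mul]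
        exact h11.trans (sub_one_dvd_pow_sub_one _ _)
      have h12 : (A : ℤ) ^ A = A ^ (2 * v) * A := by
        conv_lhs => rw [hv, pow_succ]
        rw [← hv]
      obtain ⟨w, hw⟩ := h10
      have h13 : (A : ℤ) ^ A * (1 - 2 * u) - 1 = 8 * (w * A * (1 - 2 * u)) + (1 + 2 * u) * (1 - 2 * u) - 1 := by
        rw [h12]; linear_combination (A * (1 - 2 * u)) * hw + (1 - 2 * u) * hA
      rw [h13] at hdvd
      obtain ⟨z, hz⟩ := hdvd
      have h14 : u ^ 2 = 2 * (w * A * (1 - 2 * u) - z) := by linarith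
      exact hu (hpi.dvd_of_dvd_pow (n := 2) ⟨_, h14⟩)
  · rcases eq_or_ne p 3 with rfl | h3'
    · have h9 : (A : ℤ) % 9 ≠ 7 := fun h => h7 ⟨rfl, h⟩
      push_cast at *
      have h8 : (3 : ℤ) ^ (3 * m + 2) ∣ 24 * ((A : ℤ) ^ A * (1 - 3 ^ m * u) - 1) := by
        rw [show 3 * m + 2 = 1 + (2 * m + m + 1) by omega, pow_add]
        exact mul_dvd_mul (by norm_num) hdvd
      rcases Nat.lt_or_ge 1 m with h1 | h1
      · have h10 := pow_dvd_of_dvd_expansion (p := 3) (by norm_num) rfl hZ (by exact_mod_cast h8)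
          (Dvd.dvd.mul_left (pow_dvd_pow _ (by omega)) _) (by omega)
        push_cast at h10
        omega
      · obtain rfl : m = 1 := by omega
        norm_num at h8 hA hZ
        rw [hZ] at h8
        obtain ⟨z, hz⟩ := h8
        have h10 : 3 * (z - u ^ 5 * Z + (u ^ 3 * (1 + u))) = -(u ^ 3 * (1 + u)) := by linarith
        have h11 : (3 : ℤ) ∣ u ^ 3 * (1 + u) := ⟨-(z - u ^ 5 * Z + (u ^ 3 * (1 + u))), by linarith⟩
        have h12 := (hpi.dvd_or_dvd h11).resolve_left hu3
        omega
    · have h4 : 3 < p := by have := hp.two_le; omega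
      have h8 : (p : ℤ) ^ (3 * m + 1) ∣ 24 * ((A : ℤ) ^ A * (1 - p ^ m * u) - 1) := by
        rw [show 3 * m + 1 = 2 * m + m + 1 by omega]
        exact hdvd.mul_left _
      have h10 := pow_dvd_of_dvd_expansion hp.ne_zero rfl hZ h8
        (Dvd.dvd.mul_left (pow_dvd_pow _ (by omega)) _) (by omega)
      rw [pow_one] at h10
      have h11 := (hpi.dvd_or_dvd h10).resolve_right hu3
      have h12 : p ∣ 2 ^ 2 * 3 := by exact_mod_cast h11
      rcases hp.dvd_mul.1 h12 with h13 | h13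
      · have := Nat.le_of_dvd (by norm_num) (hp.dvd_of_dvd_pow h13)
        omega
      · have := Nat.le_of_dvd (by norm_num) h13
        omega

/-- Here 243 = 3^(e+m+1) with e = 3 and m = 1. Since r^81 ≡ 1 modulo 243, exponents matter only
modulo 81 and a finite check suffices. -/
theorem not_dvd_of_mod_nine {A : ℕ} (hA : A % 9 = 7) :
    ∃ k : ℕ, ¬ (243 : ℤ) ∣ A * ((A : ℤ) ^ (A ^ k) - 1) - (A ^ k : ℕ) * A ^ (A ^ k) * (A - 1) := by
  have hdec : ∀ r : ℕ, r < 243 → r % 9 = 7 → r ^ 81 % 243 = 1 ∧ ∃ k : ℕ, k < 3 ∧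
      ((r : ℤ) * ((r : ℤ) ^ (r ^ k % 81) - 1) -
        (r ^ k : ℕ) * (r : ℤ) ^ (r ^ k % 81) * (r - 1)) % 243 ≠ 0 := by
    decide +kernel
  obtain ⟨h1, k, -, h2⟩ := hdec (A % 243) (Nat.mod_lt _ (by norm_num)) (by omega)
  refine ⟨k, fun h3 => h2 ?_⟩
  rw [← Int.dvd_iff_emod_eq_zero]
  set r := A % 243 with hr
  have hAr : A ≡ r [MOD 243] := (Nat.mod_modEq A 243).symm
  have hpow : A ^ (A ^ k) ≡ r ^ (r ^ k % 81) [MOD 243] := by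
    have h4 : A ^ k % 81 = r ^ k % 81 := (hAr.of_dvd (by norm_num)).pow k
    have h5 : r ^ 81 ≡ 1 [MOD 243] := h1
    have h6 := (h5.pow (A ^ k / 81)).mul_right (r ^ (A ^ k % 81))
    rw [← pow_mul, ← pow_add, Nat.div_add_mod, one_pow, one_mul, h4] at h6
    exact (hAr.pow _).trans h6
  have hA' := Int.natCast_modEq_iff.2 hAr
  have hP := Int.natCast_modEq_iff.2 hpow
  have hk := Int.natCast_modEq_iff.2 (hAr.pow k)
  push_cast at hA' hP hk h3 ⊢
  exact ((((hA'.mul (hP.sub_right 1)).sub ((hk.mul hP).mul (hA'.sub_right 1))).dvd_iff).1 h3)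

theorem exists_not_pow_dvd_geom_sub {A p m : ℕ} (hp : p.Prime) (hm : m ≠ 0) {u : ℤ}
    (hA : (A : ℤ) = 1 + p ^ m * u) (hu : ¬ (p : ℤ) ∣ u) :
    ∃ k : ℕ, ¬ (p : ℤ) ^ (macdonaldExp p m A + 1) ∣
      MacdonaldTriple.geom A (A ^ k) - (A ^ k : ℕ) * (A : ℤ) ^ (A ^ k) := by
  have hpi : Prime (p : ℤ) := Nat.prime_iff_prime_int.1 hp
  have hdvd : ∀ k : ℕ, (p : ℤ) ^ (macdonaldExp p m A + 1) ∣
      MacdonaldTriple.geom A (A ^ k) - (A ^ k : ℕ) * (A : ℤ) ^ (A ^ k) →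
      (p : ℤ) ^ (macdonaldExp p m A + m + 1) ∣
        A * ((A : ℤ) ^ (A ^ k) - 1) - (A ^ k : ℕ) * A ^ (A ^ k) * (A - 1) := by
    intro k h
    rw [← MacdonaldTriple.geom_sub_mul (A : ℤ) (A ^ k), show (A : ℤ) - 1 = p ^ m * u by linarith,
      show macdonaldExp p m A + m + 1 = macdonaldExp p m A + 1 + m by ring, pow_add]
    exact mul_dvd_mul h (dvd_mul_right _ _)
  by_cases h7 : p = 3 ∧ (A : ℤ) % 9 = 7
  · obtain ⟨k, hk⟩ := not_dvd_of_mod_nine (A := A) (by omega)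
    refine ⟨k, fun h => hk ?_⟩
    obtain ⟨rfl, h7⟩ := h7
    obtain rfl : m = 1 := by
      by_contra hne
      obtain ⟨n, rfl⟩ : ∃ n, m = n + 2 := ⟨m - 2, by omega⟩
      have hA' : (A : ℤ) = 1 + 9 * (3 ^ n * u) := by rw [hA]; push_cast; ring
      omega
    have h1 := hdvd k h
    have h2 : macdonaldExp 3 1 A = 3 := by simp [macdonaldExp, h7]
    rw [h2] at h1
    exact_mod_cast h1
  -- For s = A the exponent times A - 1 is A (A^A (1 - t) - 1) with t = A - 1, and A is prime to p.
  · refine ⟨1, fun h => not_pow_dvd_self_pow hp hm hA hu h7 ?_⟩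
    have h2 := hdvd 1 h
    rw [pow_one] at h2
    refine hpi.pow_dvd_of_dvd_mul_left (a := (A : ℤ)) _ ?_ ?_
    · intro h4
      have h5 : (p : ℤ) ∣ 1 := by
        rw [hA] at h4
        exact (dvd_add_left (dvd_mul_of_dvd_left (dvd_pow_self _ hm) _)).1 h4
      exact hpi.not_isUnit (isUnit_of_dvd_one h5)
    · rw [show (p : ℤ) ^ m * u = A - 1 by linarith]
      rwa [show (A : ℤ) * ((A : ℤ) ^ A * (1 - (A - 1)) - 1) =
        A * ((A : ℤ) ^ A - 1) - A * A ^ A * (A - 1) by ring]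

/-! ### Lower bound: building a Macdonald triple from permutations. -/

open MulOpposite in
theorem exists_macdonaldTriple_of_bijective {Ω : Type*} {α : ℤ} {fa fb fc : Ω → Ω} {A M : ℕ}
    (hM : M ≠ 0) (hα : (M : ℤ) ∣ α - A) (ha : fa^[M] = id) (hb : fb^[M] = id)
    (hc : Function.Bijective fc) (h1 : ∀ v, fb (fa v) = fc (fa (fb v)))
    (h2 : ∀ v, fa^[A] (fc v) = fc (fa v)) (h3 : ∀ v, fb (fc v) = fc (fb^[A] v)) :
    ∃ x y z : (Equiv.Perm Ω)ᵐᵒᵖ, MacdonaldTriple α x y z ∧ x ^ M = 1 ∧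
      ∀ n : ℕ, x ^ n = 1 → fa^[n] = id := by
  obtain ⟨k, rfl⟩ := Nat.exists_eq_succ_of_ne_zero hM
  have hl : ∀ {f : Ω → Ω}, f^[k.succ] = id → ∀ v, f^[k] (f v) = v := fun h v => by
    rw [← Function.iterate_succ_apply, h, id]
  have hr : ∀ {f : Ω → Ω}, f^[k.succ] = id → ∀ v, f (f^[k] v) = v := fun {f} h v => by
    rw [← Function.iterate_succ_apply' f, h, id]
  let ea : Equiv.Perm Ω := ⟨fa, fa^[k], hl ha, hr ha⟩
  let eb : Equiv.Perm Ω := ⟨fb, fb^[k], hl hb, hr hb⟩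
  let ec : Equiv.Perm Ω := Equiv.ofBijective fc hc
  have hpow : ∀ (e : Equiv.Perm Ω) (n : ℕ), ⇑(e ^ n) = e^[n] := fun e n =>
    (Equiv.Perm.iterate_eq_pow e n).symm
  have hea : ea ^ k.succ = 1 := by ext v; rw [hpow]; exact congrFun ha v
  have heb : eb ^ k.succ = 1 := by ext v; rw [hpow]; exact congrFun hb v
  have hz : ∀ e : Equiv.Perm Ω, e ^ k.succ = 1 → op e ^ α = op (e ^ A) := fun e he => by
    obtain ⟨y, hy⟩ := hα
    rw [show α = (k.succ : ℕ) * y + (A : ℕ) by linarith, zpow_add, zpow_mul, zpow_natCast,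
      ← op_pow, he, op_one, one_zpow, one_mul, zpow_natCast, op_pow]
  -- The maps model right multiplication, so products are taken in the opposite group.
  refine ⟨op ea, op eb, op ec, ⟨?_, ?_, ?_⟩, ?_, ?_⟩
  · rw [← op_mul, ← op_mul, ← op_mul]
    exact congrArg op (Equiv.ext fun v => h1 v)
  · rw [hz ea hea, mul_assoc, inv_mul_eq_iff_eq_mul, ← op_mul, ← op_mul]
    refine congrArg op (Equiv.ext fun v => ?_)
    rw [Equiv.Perm.mul_apply, Equiv.Perm.mul_apply, hpow]
    exact (h2 v).symm
  · rw [hz eb heb, mul_inv_eq_iff_eq_mul, ← op_mul, ← op_mul]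
    refine congrArg op (Equiv.ext fun v => ?_)
    rw [Equiv.Perm.mul_apply, Equiv.Perm.mul_apply, hpow]
    exact h3 v
  · rw [← op_pow, hea, op_one]
  · intro n hn
    rw [← op_pow, op_eq_one_iff] at hn
    rw [show fa = ⇑ea from rfl, ← hpow, hn]
    rfl

/-- A model of the Macdonald relations by permutations of a quotient of a finite abelian group. -/
theorem exists_macdonaldTriple_of_quotient {V : Type*} [AddCommGroup V] [Finite V]
    (K : AddSubgroup V) {α : ℤ} {fa fb fc : V → V} {A M : ℕ}
    (wa : ∀ v, ∀ κ ∈ K, fa (v + κ) - fa v ∈ K) (wb : ∀ v, ∀ κ ∈ K, fb (v + κ) - fb v ∈ K)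
    (wc : ∀ v, ∀ κ ∈ K, fc (v + κ) - fc v ∈ K)
    (hM : M ≠ 0) (hα : (M : ℤ) ∣ α - A) (ha : ∀ v, fa^[M] v = v) (hb : ∀ v, fb^[M] v = v)
    (hc : ∀ v, ∃ w, fc w = v) (h1 : ∀ v, fb (fa v) = fc (fa (fb v)))
    (h2 : ∀ v, fa^[A] (fc v) - fc (fa v) ∈ K) (h3 : ∀ v, fb (fc v) = fc (fb^[A] v)) :
    ∃ x y z : (Equiv.Perm (V ⧸ K))ᵐᵒᵖ, MacdonaldTriple α x y z ∧ x ^ M = 1 ∧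
      ∀ n : ℕ, x ^ n = 1 → ∀ v, fa^[n] v - v ∈ K := by
  have hmk : ∀ v w : V, (v : V ⧸ K) = w ↔ v - w ∈ K := fun v w => by
    rw [← sub_eq_zero, ← QuotientAddGroup.mk_sub, QuotientAddGroup.eq_zero_iff]
  have lift : ∀ f : V → V, (∀ v, ∀ κ ∈ K, f (v + κ) - f v ∈ K) →
      ∃ g : V ⧸ K → V ⧸ K, ∀ v : V, g v = f v := by
    intro f hf
    refine ⟨Quotient.map' f fun v w hvw => ?_, fun v => rfl⟩
    rw [QuotientAddGroup.leftRel_apply] at hvw ⊢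
    have := hf v _ hvw
    rwa [add_neg_cancel_left, sub_eq_neg_add] at this
  obtain ⟨ga, hga⟩ := lift fa wa
  obtain ⟨gb, hgb⟩ := lift fb wb
  obtain ⟨gc, hgc⟩ := lift fc wc
  have hiter : ∀ {f : V → V} {g : V ⧸ K → V ⧸ K}, (∀ v : V, g v = f v) →
      ∀ (n : ℕ) (v : V), g^[n] v = (f^[n] v : V) := by
    intro f g h n
    induction n with
    | zero => exact fun _ => rfl
    | succ n ih => intro v; rw [Function.iterate_succ_apply, h, ih, Function.iterate_succ_apply]
  obtain ⟨x, y, z, hxyz, hx, hx'⟩ := exists_macdonaldTriple_of_bijective (fa := ga) (fb := gb)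
    (fc := gc) hM hα
    (funext fun v => by
      induction v using QuotientAddGroup.induction_on with | H v => rw [hiter hga, ha]; rfl)
    (funext fun v => by
      induction v using QuotientAddGroup.induction_on with | H v => rw [hiter hgb, hb]; rfl)
    (Finite.surjective_iff_bijective.1 fun v => by
      induction v using QuotientAddGroup.induction_on with
      | H v => obtain ⟨w, hw⟩ := hc v; exact ⟨w, by rw [hgc, hw]⟩)
    (fun v => by
      induction v using QuotientAddGroup.induction_on with
      | H v => rw [hga, hgb, hgb, hga, hgc, h1])
    (fun v => by
      induction v using QuotientAddGroup.induction_on with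
      | H v => rw [hgc, hiter hga, hga, hgc, hmk]; exact h2 v)
    (fun v => by
      induction v using QuotientAddGroup.induction_on with
      | H v => rw [hgc, hgb, hiter hgb, hgc, h3])
  refine ⟨x, y, z, hxyz, hx, fun n hn v => ?_⟩
  rw [← hmk, ← hiter hga, hx' n hn, id]

/-! ### Model for odd p, except p = 3 with m = 1. -/

namespace OddModel

variable {R : Type*} [CommRing R]

/-- The power series `(α⁻¹) ^ j`, where `α = 1 + 4 σ`, `σ ^ 2 = 3 y`. -/
def invPow (σ y j : R) : R := 1 - 4 * σ * j + 24 * y * (j * (j + 1))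

/-- The power series `α + ⋯ + α ^ j`. -/
def geomSum (σ y j : R) : R := j + 2 * σ * (j ^ 2 + j) + 8 * y * (j ^ 3 - j)

/-- Right multiplication by `a` on `⟨c⟩ a ^ i b ^ j`. -/
def mulA (σ y : R) (v : R × R) : R × R := ((v.1 + 1) * invPow σ y v.2, geomSum σ y v.2)

/-- Right multiplication by `b` on `⟨c⟩ a ^ i b ^ j`. -/
def mulB (v : R × R) : R × R := (v.1, v.2 + 1)

/-- Right multiplication by `c` on `⟨c⟩ a ^ i b ^ j`. -/
def mulC (σ y : R) (v : R × R) : R × R := ((1 + 4 * σ) * v.1, (1 - 4 * σ + 48 * y) * v.2)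

/-- The exponent of `b` in `⟨c⟩ a ^ i b ^ j a ^ n`. -/
def flowB (σ y n j : R) : R := j + n * (2 * σ * (j ^ 2 + j) + 8 * y * (j ^ 3 - j)) +
  6 * y * (n * (n - 1)) * (j + 3 * j ^ 2 + 2 * j ^ 3) + y * σ * (n * (n - 1)) * (j + j ^ 2)

/-- The exponent of `a` in `⟨c⟩ a ^ i b ^ j a ^ n`. -/
def flowA (σ y n i j : R) : R :=
  i + n * (1 - 4 * σ * (j * (1 + i)) + 24 * y * (j * (j + 1) * (1 + i))) +
  n * (n - 1) * (-2 * σ * j + 12 * y * ((1 + i) * (j ^ 2 - j))) - 8 * y * (n * (n - 1) * (n - 2) * j)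

theorem geomSum_flowB {σ y : R} (h1 : σ ^ 2 = 3 * y) (h2 : y ^ 2 = 0) (h3 : 3 * y * σ = 0)
    {n j : R} (h4 : y * σ * j ^ 3 = y * σ * j)
    (h5 : y * σ * n ^ 3 = y * σ * n) :
    geomSum σ y (flowB σ y n j) = flowB σ y (n + 1) j := by
  simp only [geomSum, flowB]; grind

theorem invPow_flowB {σ y : R} (h1 : σ ^ 2 = 3 * y) (h2 : y ^ 2 = 0) (h3 : 3 * y * σ = 0)
    {n j : R} (h4 : y * σ * j ^ 3 = y * σ * j) :
    invPow σ y (flowB σ y n j) =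
      1 - 4 * σ * j + 24 * y * (j * (j + 1)) - 24 * y * n * (j ^ 2 + j) := by
  simp only [invPow, flowB]; grind

theorem flowA_add_one {σ y : R} (h1 : σ ^ 2 = 3 * y) (h2 : y ^ 2 = 0) (h3 : 3 * y * σ = 0)
    {n i j : R} (h4 : y * σ * j ^ 3 = y * σ * j)
    (h5 : y * σ * n ^ 3 = y * σ * n) :
    (flowA σ y n i j + 1) * (1 - 4 * σ * j + 24 * y * (j * (j + 1)) - 24 * y * n * (j ^ 2 + j)) =
      flowA σ y (n + 1) i j := by
  simp only [flowA]; grind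

theorem conj_flowA {σ y : R} (h1 : σ ^ 2 = 3 * y) (h2 : y ^ 2 = 0) (h3 : 3 * y * σ = 0)
    {i j τ : R} (h0 : σ = 3 * τ) :
    (1 + 4 * σ) * (((1 - 4 * σ + 48 * y) * i + 1) * invPow σ y ((1 + 4 * σ) * j)) =
      flowA σ y (1 + 4 * σ) i j + 3 * y * (-8 * j + τ * j) := by
  simp only [flowA, invPow]; grind

theorem conj_flowB {σ y : R} (h1 : σ ^ 2 = 3 * y) (h2 : y ^ 2 = 0) (h3 : 3 * y * σ = 0)
    {j τ : R} (h0 : σ = 3 * τ) (h4 : y * σ * j ^ 3 = y * σ * j) :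
    (1 - 4 * σ + 48 * y) * geomSum σ y ((1 + 4 * σ) * j) =
      flowB σ y (1 + 4 * σ) j + 3 * y * (-8 * j + τ * j) := by
  simp only [flowB, geomSum]; grind

theorem mul_inv {σ y : R} (h1 : σ ^ 2 = 3 * y) (h3 : 3 * y * σ = 0) :
    (1 + 4 * σ) * (1 - 4 * σ + 48 * y) = 1 := by grind

theorem invPow_succ {σ y : R} (h1 : σ ^ 2 = 3 * y) (h3 : 3 * y * σ = 0)
    (j : R) : invPow σ y j = (1 + 4 * σ) * invPow σ y (j + 1) := by
  simp only [invPow]; grind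

theorem geomSum_succ {σ y : R} (h1 : σ ^ 2 = 3 * y) (h2 : y ^ 2 = 0) (h3 : 3 * y * σ = 0)
    {j : R} (h4 : y * σ * j ^ 3 = y * σ * j) :
    geomSum σ y j + 1 = (1 - 4 * σ + 48 * y) * geomSum σ y (j + 1) := by
  simp only [geomSum]; grind

theorem mulA_add {σ y : R} (h2 : y ^ 2 = 0) (h3 : 3 * y * σ = 0)
    (v : R × R) (r : R) :
    mulA σ y (v + (3 * y * r, 3 * y * r)) = mulA σ y v + (3 * y * r, 3 * y * r) := by
  ext
  · simp only [mulA, invPow, Prod.fst_add, Prod.snd_add]; grind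
  · simp only [mulA, geomSum, Prod.snd_add]; grind

theorem mulC_add {σ y : R} (h2 : y ^ 2 = 0) (h3 : 3 * y * σ = 0)
    (v : R × R) (r : R) :
    mulC σ y (v + (3 * y * r, 3 * y * r)) = mulC σ y v + (3 * y * r, 3 * y * r) := by
  ext
  · simp only [mulC, Prod.fst_add]; grind
  · simp only [mulC, Prod.snd_add]; grind

theorem iterate_mulA {σ y : R} (h1 : σ ^ 2 = 3 * y) (h2 : y ^ 2 = 0) (h3 : 3 * y * σ = 0)
    (h4 : ∀ x, y * σ * x ^ 3 = y * σ * x) (n : ℕ) (v : R × R) :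
    (mulA σ y)^[n] v = (flowA σ y n v.1 v.2, flowB σ y n v.2) := by
  induction n with
  | zero => simp [flowA, flowB]
  | succ n ih =>
    rw [Function.iterate_succ_apply', ih, mulA, geomSum_flowB h1 h2 h3 (h4 _) (h4 _),
      invPow_flowB h1 h2 h3 (h4 _), flowA_add_one h1 h2 h3 (h4 _) (h4 _), Nat.cast_succ]

theorem iterate_mulB (n : ℕ) (v : R × R) : mulB^[n] v = (v.1, v.2 + n) := by
  induction n with
  | zero => simp
  | succ n ih =>
    rw [Function.iterate_succ_apply', ih, mulB, Nat.cast_succ, add_assoc]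

theorem exists_macdonaldTriple {R : Type} [CommRing R] [Finite R] {σ y τ : R} (h0 : σ = 3 * τ)
    (h1 : σ ^ 2 = 3 * y) (h2 : y ^ 2 = 0) (h3 : 3 * y * σ = 0)
    (hq : ∀ x : R, ∃ q, x ^ 3 - x = 3 * q) {α : ℤ} {A M : ℕ} (hM : M ≠ 0)
    (hM0 : (M : R) = 0) (hA : (M : ℤ) ∣ α - A) (hα : (A : R) = 1 + 4 * σ) :
    ∃ (Γ : Type) (_ : Group Γ) (a b c : Γ), MacdonaldTriple α a b c ∧ a ^ M = 1 ∧
      ∀ n : ℕ, a ^ n = 1 → (n : R) = 0 := by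
  have h4 : ∀ x, y * σ * x ^ 3 = y * σ * x := fun x => by
    obtain ⟨q, hq⟩ := hq x
    linear_combination y * σ * hq + q * h3
  -- The relation for a^A holds only up to diagonal vectors in 3yR = σ²R. Dividing them out
  -- identifies certain powers of a with powers of b, as the upper bound demands.
  let K : AddSubgroup (R × R) :=
    ((AddMonoidHom.mulLeft (3 * y)).prod (AddMonoidHom.mulLeft (3 * y))).range
  have hiter := iterate_mulA h1 h2 h3 h4
  obtain ⟨a, b, c, habc, ha, hn⟩ := exists_macdonaldTriple_of_quotient (V := R × R) K (α := α)
    (fa := mulA σ y) (fb := mulB) (fc := mulC σ y) (A := A) (M := M)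
    (by
      rintro v _ ⟨r, rfl⟩
      refine ⟨r, ?_⟩
      exact (sub_eq_of_eq_add' (mulA_add h2 h3 v r)).symm)
    (by
      rintro v _ ⟨r, rfl⟩
      refine ⟨r, ?_⟩
      ext <;> simp [mulB])
    (by
      rintro v _ ⟨r, rfl⟩
      refine ⟨r, ?_⟩
      exact (sub_eq_of_eq_add' (mulC_add h2 h3 v r)).symm)
    hM hA
    (fun v => by rw [hiter, hM0]; simp [flowA, flowB])
    (fun v => by rw [iterate_mulB, hM0, add_zero])
    (fun v => ⟨((1 - 4 * σ + 48 * y) * v.1, (1 + 4 * σ) * v.2), by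
      have := mul_inv h1 h3
      ext
      · simp only [mulC]; linear_combination v.1 * this
      · simp only [mulC]; linear_combination v.2 * this⟩)
    (fun v => by
      have e1 := invPow_succ h1 h3 v.2
      have e2 := geomSum_succ h1 h2 h3 (h4 v.2)
      ext
      · simp only [mulA, mulB, mulC]; linear_combination (v.1 + 1) * e1
      · simp only [mulA, mulB, mulC]; exact e2)
    (fun v => by
      have e0 := mul_inv h1 h3
      have e1 := conj_flowA h1 h2 h3 (i := (1 + 4 * σ) * v.1)
        (j := (1 - 4 * σ + 48 * y) * v.2) h0
      have e2 := conj_flowB h1 h2 h3 h0 (h4 ((1 - 4 * σ + 48 * y) * v.2))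
      rw [← mul_assoc (1 + 4 * σ) (1 - 4 * σ + 48 * y), e0, one_mul] at e1 e2
      rw [← mul_assoc (1 - 4 * σ + 48 * y) (1 + 4 * σ), mul_comm (1 - 4 * σ + 48 * y) (1 + 4 * σ),
        e0, one_mul] at e1
      rw [hiter, hα]
      refine ⟨-(-8 * ((1 - 4 * σ + 48 * y) * v.2) + τ * ((1 - 4 * σ + 48 * y) * v.2)), ?_⟩
      ext
      · simp only [mulA, mulC, AddMonoidHom.prod_apply, AddMonoidHom.coe_mulLeft, Prod.fst_sub]
        linear_combination e1
      · simp only [mulA, mulC, AddMonoidHom.prod_apply, AddMonoidHom.coe_mulLeft, Prod.snd_sub]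
        linear_combination e2)
    (fun v => by
      have e0 := mul_inv h1 h3
      rw [iterate_mulB, hα]
      ext
      · simp only [mulB, mulC]
      · simp only [mulB, mulC]; linear_combination -e0)
  refine ⟨_, inferInstance, a, b, c, habc, ha, fun n h => ?_⟩
  -- The origin moves to (n, 0), and a diagonal vector of this form is zero.
  obtain ⟨r, hr⟩ := hn n h (0, 0)
  rw [hiter] at hr
  have hr1 := congrArg Prod.fst hr
  have hr2 := congrArg Prod.snd hr
  simp [flowA, flowB] at hr1 hr2
  rw [← hr1, hr2]

end OddModel

/-! ### Model for p = 2 and m ≥ 2. -/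

namespace EvenModel

variable {R : Type*} [CommRing R]

/-- The power series `(α⁻¹) ^ j`, where `α = 1 + 12 f`. -/
def invPow (f j : R) : R := 1 - 12 * f * j + 72 * f ^ 2 * (j * (j + 1))

/-- The power series `α + ⋯ + α ^ j`. -/
def geomSum (f j : R) : R := j + 6 * f * (j ^ 2 + j) + 24 * f ^ 2 * (j ^ 3 - j)

/-- The exponent of `b` in `c ^ l a ^ i b ^ j a ^ (4 k)`. -/
def flowB (f k j : R) : R := j + 24 * k * f * (j ^ 2 + j) + 96 * k * f ^ 2 * (j ^ 3 - j) +
  72 * k * (4 * k - 1) * f ^ 2 * (j + 3 * j ^ 2 + 2 * j ^ 3)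

/-- The exponent of `a` in `c ^ l a ^ i b ^ j a ^ (4 k)`. -/
def flowA (f k i j : R) : R := i + 4 * k - 48 * k * f * j * (1 + i) +
  288 * k * f ^ 2 * (j * (j + 1) * (1 + i)) - 24 * k * (4 * k - 1) * f * j +
  144 * k * (4 * k - 1) * f ^ 2 * ((1 + i) * (j ^ 2 - j)) -
  192 * k * (4 * k - 1) * (2 * k - 1) * f ^ 2 * j

/-- The exponent of `c` in `c ^ l a ^ i b ^ j a ^ (4 k)`, up to the summand `l`. -/
def flowC (f k j : R) : R := -4 * k * j - 12 * k * (4 * k - 1) * f * (j ^ 2 + j) -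
  48 * k * (4 * k - 1) * f ^ 2 * (j ^ 3 - j) -
  48 * k * (4 * k - 1) * (2 * k - 1) * f ^ 2 * (j + 3 * j ^ 2 + 2 * j ^ 3) +
  8 * f ^ 3 * k * (j ^ 2 + j)

theorem flowB_add_one {f k j : R} (h1 : 32 * f ^ 3 = 0) (h2 : 16 * f ^ 3 * (j ^ 2 - j) = 0) :
    flowB f 1 (flowB f k j) = flowB f (k + 1) j := by
  simp only [flowB]; grind

theorem flowA_add_one {f k i j : R} (h1 : 32 * f ^ 3 = 0) (h2 : 16 * f ^ 3 * (j ^ 2 - j) = 0) :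
    flowA f 1 (flowA f k i j) (flowB f k j) = flowA f (k + 1) i j := by
  simp only [flowA, flowB]; grind

theorem flowC_add_one {f k j : R} (h1 : 32 * f ^ 3 = 0) (h2 : 16 * f ^ 3 * (j ^ 2 - j) = 0)
    (h3 : 16 * f ^ 3 * (k ^ 2 - k) = 0) (h4 : 8 * f ^ 3 * ((j ^ 2 - j) * (k ^ 2 - k)) = 0)
    (h5 : 8 * f ^ 3 * ((j ^ 2 - j) * (j ^ 2 - j)) = 0) :
    flowC f k j + flowC f 1 (flowB f k j) = flowC f (k + 1) j := by
  simp only [flowC, flowB]; grind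

/-- Right multiplication by `a` on `c ^ l a ^ i b ^ j`. -/
def mulA (f : R) (v : R × R × R) : R × R × R :=
  (v.1 - v.2.2, (v.2.1 + 1) * invPow f v.2.2, geomSum f v.2.2)

/-- Right multiplication by `b` on `c ^ l a ^ i b ^ j`. -/
def mulB (v : R × R × R) : R × R × R := (v.1, v.2.1, v.2.2 + 1)

/-- Right multiplication by `c` on `c ^ l a ^ i b ^ j`. -/
def mulC (f : R) (v : R × R × R) : R × R × R :=
  (v.1 + 1, (1 + 12 * f) * v.2.1, (1 - 12 * f + 144 * f ^ 2 - 1728 * f ^ 3) * v.2.2)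

theorem mulA_mulA {f : R} (h1 : 32 * f ^ 3 = 0) (v : R × R × R)
    (h2 : 16 * f ^ 3 * (v.2.2 ^ 2 - v.2.2) = 0)
    (h5 : 8 * f ^ 3 * ((v.2.2 ^ 2 - v.2.2) * (v.2.2 ^ 2 - v.2.2)) = 0) :
    mulA f (mulA f v) = (v.1 - 2 * v.2.2 - 6 * f * (v.2.2 + v.2.2 ^ 2) +
        24 * f ^ 2 * (v.2.2 - v.2.2 ^ 3),
      v.2.1 + 2 - 36 * f * v.2.2 - 24 * f * v.2.1 * v.2.2 + 72 * f ^ 2 * v.2.2 +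
        216 * f ^ 2 * v.2.2 ^ 2 + 72 * f ^ 2 * v.2.1 * v.2.2 + 216 * f ^ 2 * v.2.1 * v.2.2 ^ 2,
      v.2.2 + 12 * f * (v.2.2 + v.2.2 ^ 2) - 12 * f ^ 2 * v.2.2 + 108 * f ^ 2 * v.2.2 ^ 2 +
        120 * f ^ 2 * v.2.2 ^ 3) := by
  obtain ⟨l, i, j⟩ := v
  simp only [mulA, invPow, geomSum, Prod.mk.injEq] at *
  refine ⟨?_, ?_, ?_⟩ <;> grind

theorem iterate_four_mulA {f : R} (h1 : 32 * f ^ 3 = 0)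
    (h2 : ∀ x : R, 16 * f ^ 3 * (x ^ 2 - x) = 0)
    (h5 : ∀ x y : R, 8 * f ^ 3 * ((x ^ 2 - x) * (y ^ 2 - y)) = 0) (v : R × R × R) :
    (mulA f)^[4] v = (v.1 + flowC f 1 v.2.2, flowA f 1 v.2.1 v.2.2, flowB f 1 v.2.2) := by
  change mulA f (mulA f (mulA f (mulA f v))) = _
  rw [mulA_mulA h1 v (h2 _) (h5 _ _), mulA_mulA h1 _ (h2 _) (h5 _ _)]
  have h3 := h2 v.2.2
  have h4 := h5 v.2.2 v.2.2
  obtain ⟨l, i, j⟩ := v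
  simp only [flowA, flowB, flowC, Prod.mk.injEq] at *
  refine ⟨?_, ?_, ?_⟩ <;> grind

theorem mul_inv {f : R} (h1 : 32 * f ^ 3 = 0) :
    (1 + 12 * f) * (1 - 12 * f + 144 * f ^ 2 - 1728 * f ^ 3) = 1 := by grind

theorem invPow_succ {f : R} (h1 : 32 * f ^ 3 = 0) (j : R) :
    invPow f j = (1 + 12 * f) * invPow f (j + 1) := by
  simp only [invPow]; grind

theorem geomSum_succ {f : R} (h1 : 32 * f ^ 3 = 0) (j : R) :
    geomSum f j + 1 = (1 - 12 * f + 144 * f ^ 2 - 1728 * f ^ 3) * geomSum f (j + 1) := by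
  simp only [geomSum]; grind

theorem mulA_add {f : R} (h1 : 32 * f ^ 3 = 0) (v : R × R × R) (r s : R) :
    mulA f (v + (8 * f ^ 2 * r, 16 * f ^ 3 * r + 8 * f ^ 2 * s, 8 * f ^ 2 * s)) =
      mulA f v + (8 * f ^ 2 * (r - s), 16 * f ^ 3 * (r - s) + 8 * f ^ 2 * (s + 2 * f * s),
        8 * f ^ 2 * (s + 2 * f * s)) := by
  obtain ⟨l, i, j⟩ := v
  simp only [mulA, invPow, geomSum, Prod.mk_add_mk, Prod.mk.injEq]
  refine ⟨?_, ?_, ?_⟩ <;> grind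

theorem mulC_add {f : R} (h1 : 32 * f ^ 3 = 0) (v : R × R × R) (r s : R) :
    mulC f (v + (8 * f ^ 2 * r, 16 * f ^ 3 * r + 8 * f ^ 2 * s, 8 * f ^ 2 * s)) =
      mulC f v + (8 * f ^ 2 * r, 16 * f ^ 3 * r + 8 * f ^ 2 * (s - 12 * f * s),
        8 * f ^ 2 * (s - 12 * f * s)) := by
  obtain ⟨l, i, j⟩ := v
  simp only [mulC, Prod.mk_add_mk, Prod.mk.injEq]
  refine ⟨?_, ?_, ?_⟩ <;> grind

theorem conj_flow {f : R} (h1 : 32 * f ^ 3 = 0) {l i j q : R} (hq : j ^ 2 + j = 2 * q) :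
    (l, (1 + 12 * f) * (((1 - 12 * f + 144 * f ^ 2 - 1728 * f ^ 3) * i + 1) *
        invPow f ((1 + 12 * f) * j)),
      (1 - 12 * f + 144 * f ^ 2 - 1728 * f ^ 3) * geomSum f ((1 + 12 * f) * j)) =
    mulA f (l + (1 + 12 * f) * j + flowC f (3 * f) j, flowA f (3 * f) i j, flowB f (3 * f) j) +
      (8 * f ^ 2 * (9 * q + 14 * f * q - 6 * f ^ 2 * q),
        16 * f ^ 3 * (9 * q + 14 * f * q - 6 * f ^ 2 * q) +
          8 * f ^ 2 * (-9 * j + 3 * f * j - 5 * f * j ^ 2),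
        8 * f ^ 2 * (-9 * j + 3 * f * j - 5 * f * j ^ 2)) := by
  have h2 : 16 * f ^ 3 * (j ^ 2 + j) = 0 := by linear_combination 16 * f ^ 3 * hq + q * h1
  simp only [mulA, invPow, geomSum, flowA, flowB, flowC, Prod.mk_add_mk, Prod.mk.injEq]
  refine ⟨?_, ?_, ?_⟩
  · grind
  · grind
  · grind

theorem iterate_mulB (n : ℕ) (v : R × R × R) : mulB^[n] v = (v.1, v.2.1, v.2.2 + n) := by
  induction n with
  | zero => simp
  | succ n ih =>
    rw [Function.iterate_succ_apply', ih, mulB, Nat.cast_succ, add_assoc]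

theorem iterate_four_mul_mulA {f : R} (h1 : 32 * f ^ 3 = 0)
    (h2 : ∀ x : R, 16 * f ^ 3 * (x ^ 2 - x) = 0)
    (h5 : ∀ x y : R, 8 * f ^ 3 * ((x ^ 2 - x) * (y ^ 2 - y)) = 0) (k : ℕ) (v : R × R × R) :
    (mulA f)^[4 * k] v = (v.1 + flowC f k v.2.2, flowA f k v.2.1 v.2.2, flowB f k v.2.2) := by
  induction k with
  | zero => simp [flowA, flowB, flowC]
  | succ k ih =>
    rw [show 4 * (k + 1) = 4 + 4 * k by ring, Function.iterate_add_apply, ih,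
      iterate_four_mulA h1 h2 h5, flowA_add_one h1 (h2 _), flowB_add_one h1 (h2 _), add_assoc,
      flowC_add_one h1 (h2 _) (h2 _) (h5 _ _) (h5 _ _), Nat.cast_succ]

/-- The equivalence relation on the words `c ^ l a ^ i b ^ j`, as a subgroup. -/
def kernel (f : R) : AddSubgroup (R × R × R) :=
  (((AddMonoidHom.mulLeft (8 * f ^ 2)).comp (AddMonoidHom.fst R R)).prod
    (((AddMonoidHom.mulLeft (16 * f ^ 3)).comp (AddMonoidHom.fst R R) +
      (AddMonoidHom.mulLeft (8 * f ^ 2)).comp (AddMonoidHom.snd R R)).prod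
      ((AddMonoidHom.mulLeft (8 * f ^ 2)).comp (AddMonoidHom.snd R R)))).range

theorem mem_kernel {f : R} {v : R × R × R} : v ∈ kernel f ↔
    ∃ r s, (8 * f ^ 2 * r, 16 * f ^ 3 * r + 8 * f ^ 2 * s, 8 * f ^ 2 * s) = v := by
  simp [kernel, AddMonoidHom.mem_range]

/-- The exponent of c is kept because `kernel` ties a^(16f³) to c^(8f²); cosets of ⟨c⟩ would lose
that power of a. Closed formulas for a^(4k) are enough, since the parameter is 1 + 4k. -/
theorem exists_macdonaldTriple {R : Type} [CommRing R] [Finite R] {f : R} (h1 : 32 * f ^ 3 = 0)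
    (hq : ∀ x : R, ∃ q, x ^ 2 - x = 2 * q) {α : ℤ} {k M : ℕ} (hM : M ≠ 0)
    (hM0 : (M : R) = 0) (hα : ((4 * M : ℕ) : ℤ) ∣ α - (1 + 4 * k : ℕ)) (hk : (k : R) = 3 * f) :
    ∃ (Γ : Type) (_ : Group Γ) (a b c : Γ), MacdonaldTriple α a b c ∧ a ^ (4 * M) = 1 ∧
      ∀ n : ℕ, a ^ (4 * n) = 1 → (4 * n : R) = 0 := by
  have h2 : ∀ x : R, 16 * f ^ 3 * (x ^ 2 - x) = 0 := fun x => by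
    obtain ⟨q, hq⟩ := hq x
    linear_combination 16 * f ^ 3 * hq + q * h1
  have h5 : ∀ x y : R, 8 * f ^ 3 * ((x ^ 2 - x) * (y ^ 2 - y)) = 0 := fun x y => by
    obtain ⟨q, hx⟩ := hq x
    obtain ⟨r, hr⟩ := hq y
    linear_combination 8 * f ^ 3 * (y ^ 2 - y) * hx + 16 * f ^ 3 * q * hr + q * r * h1
  have hiter := iterate_four_mul_mulA h1 h2 h5
  have hinv := mul_inv h1
  obtain ⟨a, b, c, habc, ha, hn⟩ := exists_macdonaldTriple_of_quotient (V := R × R × R) (kernel f)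
    (α := α) (fa := mulA f) (fb := mulB) (fc := mulC f) (A := 1 + 4 * k) (M := 4 * M)
    (by
      intro v κ hκ
      obtain ⟨r, s, rfl⟩ := mem_kernel.1 hκ
      exact mem_kernel.2 ⟨_, _, (sub_eq_of_eq_add' (mulA_add h1 v r s)).symm⟩)
    (by
      intro v κ hκ
      obtain ⟨r, s, rfl⟩ := mem_kernel.1 hκ
      refine mem_kernel.2 ⟨r, s, ?_⟩
      ext <;> simp [mulB])
    (by
      intro v κ hκ
      obtain ⟨r, s, rfl⟩ := mem_kernel.1 hκ
      exact mem_kernel.2 ⟨_, _, (sub_eq_of_eq_add' (mulC_add h1 v r s)).symm⟩)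
    (by omega) hα
    (fun v => by rw [hiter, hM0]; simp [flowA, flowB, flowC])
    (fun v => by rw [iterate_mulB]; simp [hM0])
    (fun v => ⟨(v.1 - 1, (1 - 12 * f + 144 * f ^ 2 - 1728 * f ^ 3) * v.2.1,
        (1 + 12 * f) * v.2.2), by
      ext
      · simp [mulC]
      · simp only [mulC]; linear_combination v.2.1 * hinv
      · simp only [mulC]; linear_combination v.2.2 * hinv⟩)
    (fun v => by
      have e1 := invPow_succ h1 v.2.2
      have e2 := geomSum_succ h1 v.2.2
      ext
      · simp only [mulA, mulB, mulC]; ring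
      · simp only [mulA, mulB, mulC]; linear_combination (v.2.1 + 1) * e1
      · simp only [mulA, mulB, mulC]; exact e2)
    (fun v => by
      obtain ⟨q, hq⟩ := hq ((1 - 12 * f + 144 * f ^ 2 - 1728 * f ^ 3) * v.2.2)
      have e := conj_flow h1 (l := v.1 - v.2.2 + 1) (i := (1 + 12 * f) * v.2.1)
        (j := (1 - 12 * f + 144 * f ^ 2 - 1728 * f ^ 3) * v.2.2)
        (q := q + (1 - 12 * f + 144 * f ^ 2 - 1728 * f ^ 3) * v.2.2) (by linear_combination hq)
      have e1 : (1 + 12 * f) * ((1 - 12 * f + 144 * f ^ 2 - 1728 * f ^ 3) * v.2.2) = v.2.2 := by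
        linear_combination v.2.2 * hinv
      have e2 : (1 - 12 * f + 144 * f ^ 2 - 1728 * f ^ 3) * ((1 + 12 * f) * v.2.1) = v.2.1 := by
        linear_combination v.2.1 * hinv
      rw [e1, e2] at e
      rw [Function.iterate_add_apply, hiter, Function.iterate_one, ← neg_mem_iff, neg_sub, hk]
      rw [show v.1 - v.2.2 + 1 + v.2.2 = v.1 + 1 by ring] at e
      exact mem_kernel.2 ⟨_, _, (sub_eq_of_eq_add' e).symm⟩)
    (fun v => by
      rw [iterate_mulB]
      ext
      · simp only [mulB, mulC]
      · simp only [mulB, mulC]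
      · simp only [mulB, mulC]; push_cast; rw [hk]; linear_combination -hinv)
  refine ⟨_, inferInstance, a, b, c, habc, ha, fun n h => ?_⟩
  obtain ⟨r, s, hr⟩ := mem_kernel.1 (hn _ h (0, 0, 0))
  rw [hiter] at hr
  simp [flowA, flowB, flowC] at hr
  obtain ⟨hr1, hr2, hr3⟩ := hr
  -- The first coordinate gives 8f²r = 0, which also kills 16f³r; the third gives 8f²s = 0.
  linear_combination -hr2 + 2 * f * hr1 + hr3

end EvenModel

/-! ### Model for p = 3 and m = 1. -/

namespace TernaryModel

variable {R : Type*} [CommRing R]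

/-- The power series `(α⁻¹) ^ j`, where `α = 1 + 12 f`. -/
def invPow (f j : R) : R := 1 - 12 * f * j + 72 * f ^ 2 * (j * (j + 1)) -
  45 * f ^ 3 * (j * (j + 1) * (j + 2)) + 54 * f ^ 4 * (j * (j + 1) * (j + 2) * (j + 3))

/-- The power series `α + ⋯ + α ^ j`. -/
def geomSum (f j : R) : R := j + 6 * f * (j ^ 2 + j) + 24 * f ^ 2 * (j ^ 3 - j) +
  72 * f ^ 3 * ((j ^ 3 - j) * (j - 2))

/-- The exponent of `b` in `⟨c⟩ a ^ i b ^ j a ^ (3 k)`. -/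
def flowB (f k j : R) : R := j + 18 * k * f * (j ^ 2 + j) + 9 * k * f ^ 2 * (4 * j + 5 * j ^ 3)

/-- The exponent of `a` in `⟨c⟩ a ^ i b ^ j a ^ (3 k)`. -/
def flowA (f k i j : R) : R := i + 3 * k + 63 * f * j * k + 27 * f * j * k ^ 2 +
  45 * f * i * j * k + k * f ^ 2 * (72 * j + i * (27 * j + 54 * j ^ 2)) +
  9 * k * f ^ 3 * (4 * j + 8 * j ^ 3) + 54 * k * f * (j ^ 2 + i * j)

/-- Right multiplication by `a` on `⟨c⟩ a ^ i b ^ j`. -/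
def mulA (f : R) (v : R × R) : R × R := ((v.1 + 1) * invPow f v.2, geomSum f v.2)

/-- Right multiplication by `b` on `⟨c⟩ a ^ i b ^ j`. -/
def mulB (v : R × R) : R × R := (v.1, v.2 + 1)

/-- Right multiplication by `c` on `⟨c⟩ a ^ i b ^ j`. -/
def mulC (f : R) (v : R × R) : R × R :=
  ((1 + 12 * f) * v.1, (1 - 12 * f + 144 * f ^ 2 - 1728 * f ^ 3) * v.2)

theorem flowB_add_one {f k j : R} (h : (81 : R) = 0) :
    flowB f 1 (flowB f k j) = flowB f (k + 1) j := by
  simp only [flowB]; grind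

theorem flowA_add_one {f k i j : R} (h : (81 : R) = 0) :
    flowA f 1 (flowA f k i j) (flowB f k j) = flowA f (k + 1) i j := by
  simp only [flowA, flowB]; grind

theorem mulA_mulA {f : R} (h : (81 : R) = 0) (v : R × R)
    (h1 : 27 * v.2 ^ 3 = 27 * v.2) (h2 : 27 * f ^ 3 = 27 * f)
    (h3 : 9 * (v.2 ^ 3 - v.2) ^ 2 = 0) (h4 : 9 * (v.2 ^ 3 - v.2) * (f ^ 3 - f) = 0) :
    mulA f (mulA f v) = (2 + v.1 + 54 * f * v.2 + 27 * f * v.2 ^ 2 + 18 * f * v.2 ^ 3 +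
        57 * f * v.1 * v.2 + 45 * f ^ 2 * v.2 + 27 * f ^ 2 * v.2 ^ 2 + 18 * f ^ 2 * v.1 * v.2,
      v.2 + 48 * f * v.2 + 66 * f * v.2 ^ 2 + 18 * f * v.2 ^ 3 + 51 * f ^ 2 * v.2 +
        54 * f ^ 2 * v.2 ^ 2 + 3 * f ^ 2 * v.2 ^ 3 + 18 * f ^ 3 * v.2 + 18 * f ^ 3 * v.2 ^ 2) := by
  obtain ⟨i, j⟩ := v
  simp only [mulA, invPow, geomSum, Prod.mk.injEq] at *
  refine ⟨?_, ?_⟩ <;> grind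

theorem iterate_three_mulA {f : R} (h : (81 : R) = 0) (v : R × R)
    (h1 : 27 * v.2 ^ 3 = 27 * v.2) (h2 : 27 * f ^ 3 = 27 * f)
    (h3 : 9 * (v.2 ^ 3 - v.2) ^ 2 = 0) (h4 : 9 * (v.2 ^ 3 - v.2) * (f ^ 3 - f) = 0) :
    (mulA f)^[3] v = (flowA f 1 v.1 v.2, flowB f 1 v.2) := by
  change mulA f (mulA f (mulA f v)) = _
  rw [mulA_mulA h v h1 h2 h3 h4]
  obtain ⟨i, j⟩ := v
  simp only [mulA, invPow, geomSum, flowA, flowB, Prod.mk.injEq] at *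
  refine ⟨?_, ?_⟩ <;> grind

theorem mul_inv {f : R} (h : (81 : R) = 0) :
    (1 + 12 * f) * (1 - 12 * f + 144 * f ^ 2 - 1728 * f ^ 3) = 1 := by grind

theorem invPow_succ {f j : R} (h : (81 : R) = 0) :
    invPow f j = (1 + 12 * f) * invPow f (j + 1) := by
  simp only [invPow]; grind

theorem geomSum_succ {f j : R} (h : (81 : R) = 0) (h1 : 27 * j ^ 3 = 27 * j)
    (h4 : 9 * (j ^ 3 - j) * (f ^ 3 - f) = 0) :
    geomSum f j + 1 = (1 - 12 * f + 144 * f ^ 2 - 1728 * f ^ 3) * geomSum f (j + 1) := by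
  simp only [geomSum]; grind

theorem conj_flow {f i j : R} (h : (81 : R) = 0) (h1 : 27 * j ^ 3 = 27 * j)
    (h2 : 27 * f ^ 3 = 27 * f)
    (h4 : 9 * (j ^ 3 - j) * (f ^ 3 - f) = 0) :
    ((1 + 12 * f) * (((1 - 12 * f + 144 * f ^ 2 - 1728 * f ^ 3) * i + 1) *
        invPow f ((1 + 12 * f) * j)),
      (1 - 12 * f + 144 * f ^ 2 - 1728 * f ^ 3) * geomSum f ((1 + 12 * f) * j)) =
    mulA f (flowA f (4 * f) i j, flowB f (4 * f) j) +
      (27 * f * j ^ 2 + 27 * f ^ 2 * j + 9 * f ^ 2 * j ^ 3 + 9 * f ^ 3 * j,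
        63 * f * j + 18 * f * j ^ 3 + 36 * f ^ 2 * j + 54 * f ^ 2 * j ^ 2 + 9 * f ^ 3 * j) := by
  simp only [mulA, invPow, geomSum, flowA, flowB, Prod.mk_add_mk, Prod.mk.injEq]
  refine ⟨?_, ?_⟩
  · grind
  · grind

theorem mulA_add {f κ : R} (hκ : 3 * κ = 0) (v : R × R) (r : R) :
    mulA f (v + (κ * r, κ * r)) = mulA f v + (κ * r, κ * r) := by
  obtain ⟨i, j⟩ := v
  simp only [mulA, invPow, geomSum, Prod.mk_add_mk, Prod.mk.injEq]
  refine ⟨?_, ?_⟩ <;> grind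

theorem mulC_add {f κ : R} (hκ : 3 * κ = 0) (v : R × R) (r : R) :
    mulC f (v + (κ * r, κ * r)) = mulC f v + (κ * r, κ * r) := by
  obtain ⟨i, j⟩ := v
  simp only [mulC, Prod.mk_add_mk, Prod.mk.injEq]
  refine ⟨?_, ?_⟩ <;> grind

theorem iterate_mulB (n : ℕ) (v : R × R) : mulB^[n] v = (v.1, v.2 + n) := by
  induction n with
  | zero => simp
  | succ n ih =>
    rw [Function.iterate_succ_apply', ih, mulB, Nat.cast_succ, add_assoc]

/-- By `hK` the failure of the relation for a^A is diagonal with entries in κR. The two residues of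
α modulo 9 allow different κ, whence the exceptional value of `macdonaldExp`. -/
theorem exists_macdonaldTriple {R : Type} [CommRing R] [Finite R] {f κ : R} (h : (81 : R) = 0)
    (hκ : 3 * κ = 0) (hq : ∀ x : R, ∃ q, x ^ 3 - x = 3 * q)
    (hK : ∀ j : R, ∃ r,
      27 * f * j ^ 2 + 27 * f ^ 2 * j + 9 * f ^ 2 * j ^ 3 + 9 * f ^ 3 * j = κ * r ∧
      63 * f * j + 18 * f * j ^ 3 + 36 * f ^ 2 * j + 54 * f ^ 2 * j ^ 2 + 9 * f ^ 3 * j = κ * r)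
    {α : ℤ} {k M : ℕ} (hM : M ≠ 0) (hM0 : (M : R) = 0)
    (hα : ((3 * M : ℕ) : ℤ) ∣ α - (1 + 3 * k : ℕ)) (hk : (k : R) = 4 * f) :
    ∃ (Γ : Type) (_ : Group Γ) (a b c : Γ), MacdonaldTriple α a b c ∧ a ^ (3 * M) = 1 ∧
      ∀ n : ℕ, a ^ (3 * n) = 1 → (3 * n : R) = 0 := by
  have h1 : ∀ x : R, 27 * x ^ 3 = 27 * x := fun x => by
    obtain ⟨q, hx⟩ := hq x
    linear_combination 27 * hx + q * h
  have h4 : ∀ x y : R, 9 * (x ^ 3 - x) * (y ^ 3 - y) = 0 := fun x y => by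
    obtain ⟨q, hx⟩ := hq x
    obtain ⟨r, hy⟩ := hq y
    linear_combination 9 * (y ^ 3 - y) * hx + 27 * q * hy + q * r * h
  have h3 : ∀ x : R, 9 * (x ^ 3 - x) ^ 2 = 0 := fun x => by linear_combination h4 x x
  have hiter : ∀ (k : ℕ) (v : R × R),
      (mulA f)^[3 * k] v = (flowA f k v.1 v.2, flowB f k v.2) := fun k v => by
    induction k with
    | zero => simp [flowA, flowB]
    | succ k ih =>
      rw [show 3 * (k + 1) = 3 + 3 * k by ring, Function.iterate_add_apply, ih,
        iterate_three_mulA h _ (h1 _) (h1 _) (h3 _) (h4 _ _), flowA_add_one h,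
        flowB_add_one h, Nat.cast_succ]
  have hinv := mul_inv (f := f) h
  let K : AddSubgroup (R × R) := ((AddMonoidHom.mulLeft κ).prod (AddMonoidHom.mulLeft κ)).range
  obtain ⟨a, b, c, habc, ha, hn⟩ := exists_macdonaldTriple_of_quotient (V := R × R) K
    (α := α) (fa := mulA f) (fb := mulB) (fc := mulC f) (A := 1 + 3 * k) (M := 3 * M)
    (by
      rintro v _ ⟨r, rfl⟩
      exact ⟨r, (sub_eq_of_eq_add' (mulA_add hκ v r)).symm⟩)
    (by
      rintro v _ ⟨r, rfl⟩
      refine ⟨r, ?_⟩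
      ext <;> simp [mulB])
    (by
      rintro v _ ⟨r, rfl⟩
      exact ⟨r, (sub_eq_of_eq_add' (mulC_add hκ v r)).symm⟩)
    (by omega) hα
    (fun v => by rw [hiter, hM0]; simp [flowA, flowB])
    (fun v => by rw [iterate_mulB]; simp [hM0])
    (fun v => ⟨((1 - 12 * f + 144 * f ^ 2 - 1728 * f ^ 3) * v.1, (1 + 12 * f) * v.2), by
      ext
      · simp only [mulC]; linear_combination v.1 * hinv
      · simp only [mulC]; linear_combination v.2 * hinv⟩)
    (fun v => by
      have e1 := invPow_succ (f := f) (j := v.2) h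
      have e2 := geomSum_succ h (h1 v.2) (h4 v.2 f)
      ext
      · simp only [mulA, mulB, mulC]; linear_combination (v.1 + 1) * e1
      · simp only [mulA, mulB, mulC]; exact e2)
    (fun v => by
      have e := conj_flow (f := f) (i := (1 + 12 * f) * v.1)
        (j := (1 - 12 * f + 144 * f ^ 2 - 1728 * f ^ 3) * v.2) h (h1 _) (h1 _) (h4 _ _)
      have e1 : (1 + 12 * f) * ((1 - 12 * f + 144 * f ^ 2 - 1728 * f ^ 3) * v.2) = v.2 := by
        linear_combination v.2 * hinv
      have e2 : (1 - 12 * f + 144 * f ^ 2 - 1728 * f ^ 3) * ((1 + 12 * f) * v.1) = v.1 := by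
        linear_combination v.1 * hinv
      rw [e1, e2] at e
      obtain ⟨r, hr1, hr2⟩ := hK ((1 - 12 * f + 144 * f ^ 2 - 1728 * f ^ 3) * v.2)
      rw [hr1, hr2] at e
      rw [Function.iterate_add_apply, hiter, Function.iterate_one, ← neg_mem_iff, neg_sub, hk]
      exact ⟨r, (sub_eq_of_eq_add' e).symm⟩)
    (fun v => by
      rw [iterate_mulB]
      ext
      · simp only [mulB, mulC]
      · simp only [mulB, mulC]; push_cast; rw [hk]; linear_combination -hinv)
  refine ⟨_, inferInstance, a, b, c, habc, ha, fun n hn' => ?_⟩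
  obtain ⟨r, hr⟩ := hn _ hn' (0, 0)
  rw [hiter] at hr
  have hr1 := congrArg Prod.fst hr
  have hr2 := congrArg Prod.snd hr
  simp [flowA, flowB] at hr1 hr2
  rw [← hr1, hr2]

end TernaryModel

/-! ### Choice of parameters in the models. -/

theorem ZMod.exists_sq_sub_eq_two_mul {n : ℕ} (x : ZMod n) : ∃ q, x ^ 2 - x = 2 * q := by
  obtain ⟨y, rfl⟩ := ZMod.intCast_surjective x
  obtain ⟨q, hq⟩ : (2 : ℤ) ∣ y ^ 2 - y := by
    rw [show y ^ 2 - y = y * (y - 1) by ring]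
    rcases Int.even_or_odd' y with ⟨z, rfl | rfl⟩
    · exact ⟨z * (2 * z - 1), by ring⟩
    · exact ⟨(2 * z + 1) * z, by ring⟩
  exact ⟨q, by exact_mod_cast congrArg (Int.cast : ℤ → ZMod n) hq⟩

theorem ZMod.exists_cube_sub_eq_three_mul {n : ℕ} (x : ZMod n) : ∃ q, x ^ 3 - x = 3 * q := by
  obtain ⟨y, rfl⟩ := ZMod.intCast_surjective x
  have : Fact (Nat.Prime 3) := ⟨Nat.prime_three⟩
  obtain ⟨q, hq⟩ : ((3 : ℕ) : ℤ) ∣ y ^ 3 - y := by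
    rw [← ZMod.intCast_zmod_eq_zero_iff_dvd]
    push_cast
    rw [ZMod.pow_card, sub_self]
  exact ⟨q, by exact_mod_cast congrArg (Int.cast : ℤ → ZMod n) hq⟩

theorem exists_natCast_dvd_sub {M : ℕ} (hM : M ≠ 0) (κ : ℤ) : ∃ k : ℕ, (M : ℤ) ∣ κ - k := by
  refine ⟨(κ % M).toNat, ?_⟩
  rw [Int.toNat_of_nonneg (Int.emod_nonneg _ (by exact_mod_cast hM))]
  exact Int.dvd_self_sub_emod

theorem natCast_zmod_eq_of_dvd_sub {M k : ℕ} {κ : ℤ} (h : (M : ℤ) ∣ κ - k) :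
    (k : ZMod M) = (κ : ZMod M) := by
  have := (ZMod.intCast_eq_intCast_iff_dvd_sub (k : ℤ) κ M).2 h
  exact_mod_cast this

/-- This is the case p = 2, m = 1: if x⁴ = 1 and α ≡ 3 modulo 4, then x^α = x⁻¹. -/
theorem exists_macdonaldTriple_quaternion {α : ℤ} (hα : α % 4 = 3) :
    ∃ (Γ : Type) (_ : Group Γ) (a b c : Γ), MacdonaldTriple α a b c ∧ a ^ 4 = 1 ∧ a ^ 2 ≠ 1 := by
  have hz : ∀ x : QuaternionGroup 4, x ^ 4 = 1 → x ^ α = x⁻¹ := fun x hx => by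
    obtain ⟨w, rfl⟩ : ∃ w, α = 4 * w + (-1) := ⟨(α + 1) / 4, by omega⟩
    rw [zpow_add, zpow_mul, show x ^ (4 : ℤ) = x ^ 4 from zpow_natCast x 4, hx, one_zpow, one_mul,
      zpow_neg_one]
  refine ⟨QuaternionGroup 4, inferInstance, .xa 0, .xa 1, .a 2, ⟨?_, ?_, ?_⟩, ?_, ?_⟩
  · decide
  · rw [hz _ (by decide)]; decide
  · rw [hz _ (by decide)]; decide
  · decide
  · decide

theorem exists_macdonaldTriple_of_two {m : ℕ} (hm : 2 ≤ m) {α u : ℤ}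
    (hα : α = 1 + 2 ^ m * u) :
    ∃ (Γ : Type) (_ : Group Γ) (a b c : Γ), MacdonaldTriple α a b c ∧
      a ^ 2 ^ (3 * m + 1) = 1 ∧ a ^ 2 ^ (3 * m - 2) ≠ 1 := by
  obtain ⟨m, rfl⟩ := Nat.exists_eq_add_of_le' hm
  -- After the shift of m by 2, f is 2^m u / 3, so this modulus gives 32f³ = 0.
  set M := 2 ^ (3 * m + 5) with hMdef
  have : NeZero M := ⟨by positivity⟩
  obtain ⟨k, hk⟩ := exists_natCast_dvd_sub (M := M) (by positivity) (2 ^ m * u)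
  obtain ⟨θ, hθ⟩ : ∃ θ : ZMod M, 3 * θ = 1 := ⟨_, by
    have := ZMod.coe_mul_inv_eq_one (n := M) 3 (Nat.Coprime.pow_right _ (by norm_num))
    exact_mod_cast this⟩
  have hM0 : (2 : ZMod M) ^ (3 * m + 5) = 0 := by
    have := ZMod.natCast_self M
    rw [hMdef] at this
    push_cast at this
    exact this
  have hkM := natCast_zmod_eq_of_dvd_sub hk
  push_cast at hkM
  obtain ⟨Γ, hΓ, a, b, c, habc, ha, hn⟩ := EvenModel.exists_macdonaldTriple (R := ZMod M)
    (f := θ * (2 ^ m * u)) (α := α) (k := k) (M := M)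
    (by linear_combination (θ * u) ^ 3 * hM0)
    ZMod.exists_sq_sub_eq_two_mul (by positivity) (ZMod.natCast_self M)
    (by
      obtain ⟨w, hw⟩ := hk
      exact ⟨w, by rw [hα]; push_cast; linear_combination 4 * hw⟩)
    (by rw [hkM, ← mul_assoc, hθ, one_mul])
  refine ⟨Γ, hΓ, a, b, c, habc, ?_, fun h => ?_⟩
  · rw [← ha, hMdef]; congr 1; ring
  · rw [show 2 ^ (3 * (m + 2) - 2) = 4 * 2 ^ (3 * m + 2) by
      rw [show 3 * (m + 2) - 2 = 2 + (3 * m + 2) by omega, pow_add]; norm_num] at h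
    have := hn _ h
    rw [show (4 : ZMod M) * ((2 ^ (3 * m + 2) : ℕ) : ZMod M) = ((2 ^ (3 * m + 4) : ℕ) : ZMod M) by
      push_cast; ring, ZMod.natCast_eq_zero_iff, hMdef] at this
    have := (Nat.pow_dvd_pow_iff_le_right (by norm_num)).1 this
    omega

theorem TernaryModel.discrepancy_of_mod_nine_eq_four {R : Type*} [CommRing R] {f j ω q : R}
    (h : (27 : R) = 0) (hq : j ^ 3 - j = 3 * q) (hf : f = 1 + 3 * ω) :
    27 * f * j ^ 2 + 27 * f ^ 2 * j + 9 * f ^ 2 * j ^ 3 + 9 * f ^ 3 * j = 9 * (2 * j) ∧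
    63 * f * j + 18 * f * j ^ 3 + 36 * f ^ 2 * j + 54 * f ^ 2 * j ^ 2 + 9 * f ^ 3 * j =
      9 * (2 * j) := by
  subst hf
  constructor <;> grind

theorem TernaryModel.discrepancy_of_mod_nine_eq_seven {R : Type*} [CommRing R] {f j ω q : R}
    (h : (81 : R) = 0) (hq : j ^ 3 - j = 3 * q) (hf : f = -1 + 3 * ω) :
    27 * f * j ^ 2 + 27 * f ^ 2 * j + 9 * f ^ 2 * j ^ 3 + 9 * f ^ 3 * j =
      27 * (-2 * j - 2 * q + 2 * j ^ 2 + ω * j) ∧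
    63 * f * j + 18 * f * j ^ 3 + 36 * f ^ 2 * j + 54 * f ^ 2 * j ^ 2 + 9 * f ^ 3 * j =
      27 * (-2 * j - 2 * q + 2 * j ^ 2 + ω * j) := by
  subst hf
  constructor <;> grind

theorem exists_macdonaldTriple_of_mod_nine_eq_four {α : ℤ} (hα : α % 9 = 4) :
    ∃ (Γ : Type) (_ : Group Γ) (a b c : Γ), MacdonaldTriple α a b c ∧
      a ^ 3 ^ 4 = 1 ∧ a ^ 3 ^ 2 ≠ 1 := by
  obtain ⟨w, rfl⟩ : ∃ w, α = 1 + 3 * (3 * w + 1) := ⟨α / 9, by omega⟩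
  obtain ⟨k, hk⟩ := exists_natCast_dvd_sub (M := 27) (by norm_num) (3 * w + 1)
  have hkM := natCast_zmod_eq_of_dvd_sub hk
  push_cast at hkM
  have h27 : (27 : ZMod 27) = 0 := by decide
  -- Since -20 inverts 4 modulo 27, f = -20(3w + 1) solves 4f = 3w + 1.
  obtain ⟨Γ, hΓ, a, b, c, habc, ha, hn⟩ := TernaryModel.exists_macdonaldTriple (R := ZMod 27)
    (f := 1 + 3 * (-20 * w - 7)) (κ := 9) (α := 1 + 3 * (3 * w + 1)) (k := k) (M := 27)
    (by decide) (by decide) ZMod.exists_cube_sub_eq_three_mul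
    (fun j => by
      obtain ⟨q, hq⟩ := ZMod.exists_cube_sub_eq_three_mul j
      exact ⟨2 * j, TernaryModel.discrepancy_of_mod_nine_eq_four h27 hq rfl⟩)
    (by norm_num) (by decide)
    (by
      obtain ⟨v, hv⟩ := hk
      exact ⟨v, by push_cast at hv ⊢; linear_combination 3 * hv⟩)
    (by rw [hkM]; linear_combination (9 * w + 3) * h27)
  refine ⟨Γ, hΓ, a, b, c, habc, ha, fun h => ?_⟩
  have := hn 3 h
  revert this
  decide

theorem exists_macdonaldTriple_of_mod_nine_eq_seven {α : ℤ} (hα : α % 9 = 7) :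
    ∃ (Γ : Type) (_ : Group Γ) (a b c : Γ), MacdonaldTriple α a b c ∧
      a ^ 3 ^ 5 = 1 ∧ a ^ 3 ^ 3 ≠ 1 := by
  obtain ⟨w, rfl⟩ : ∃ w, α = 1 + 3 * (3 * w + 2) := ⟨α / 9, by omega⟩
  obtain ⟨k, hk⟩ := exists_natCast_dvd_sub (M := 81) (by norm_num) (3 * w + 2)
  have hkM := natCast_zmod_eq_of_dvd_sub hk
  push_cast at hkM
  have h81 : (81 : ZMod 81) = 0 := by decide
  -- Also modulo 81 the inverse of 4 is -20, so f = -20(3w + 2).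
  obtain ⟨Γ, hΓ, a, b, c, habc, ha, hn⟩ := TernaryModel.exists_macdonaldTriple (R := ZMod 81)
    (f := -1 + 3 * (-20 * w - 13)) (κ := 27) (α := 1 + 3 * (3 * w + 2)) (k := k) (M := 81)
    (by decide) (by decide) ZMod.exists_cube_sub_eq_three_mul
    (fun j => by
      obtain ⟨q, hq⟩ := ZMod.exists_cube_sub_eq_three_mul j
      exact ⟨_, TernaryModel.discrepancy_of_mod_nine_eq_seven h81 hq rfl⟩)
    (by norm_num) (by decide)
    (by
      obtain ⟨v, hv⟩ := hk
      exact ⟨v, by push_cast at hv ⊢; linear_combination 3 * hv⟩)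
    (by rw [hkM]; linear_combination (3 * w + 2) * h81)
  refine ⟨Γ, hΓ, a, b, c, habc, ha, fun h => ?_⟩
  have := hn 9 h
  revert this
  decide

theorem exists_macdonaldTriple_of_odd {p m : ℕ} (hp : p.Prime) (h2 : p ≠ 2)
    (hm : m ≠ 0) (h3 : p = 3 → m ≠ 1) {α u : ℤ} (hα : α = 1 + p ^ m * u) :
    ∃ (Γ : Type) (_ : Group Γ) (a b c : Γ), MacdonaldTriple α a b c ∧
      a ^ p ^ (3 * m) = 1 ∧ a ^ p ^ (3 * m - 1) ≠ 1 := by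
  set M := p ^ (3 * m) with hMdef
  have hM : M ≠ 0 := pow_ne_zero _ hp.ne_zero
  have : NeZero M := ⟨hM⟩
  obtain ⟨A, hA⟩ := exists_natCast_dvd_sub hM α
  have hAM := natCast_zmod_eq_of_dvd_sub hA
  rw [hα] at hAM
  push_cast at hAM
  obtain ⟨θ, hθ⟩ : ∃ θ : ZMod M, 4 * θ = 1 := ⟨_, by
    have := ZMod.coe_mul_inv_eq_one (n := M) 4 (Nat.Coprime.pow_right _
      ((Nat.Coprime.pow_left 2 ((Nat.coprime_primes Nat.prime_two hp).2 h2.symm))))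
    exact_mod_cast this⟩
  have hM0 : (p : ZMod M) ^ (3 * m) = 0 := by
    have := ZMod.natCast_self M
    rw [hMdef] at this
    push_cast at this
    exact this
  -- The modulus p^(3m) gives σ³ = 0. The divisions by 3 use m ≥ 2 when p = 3, and that 3 is a unit
  -- otherwise.
  obtain ⟨σ, y, τ, e, e0, e1, e2, e3⟩ : ∃ σ y τ : ZMod M, 4 * σ = p ^ m * u ∧ σ = 3 * τ ∧
      σ ^ 2 = 3 * y ∧ y ^ 2 = 0 ∧ 3 * y * σ = 0 := by
    by_cases hp3 : p = 3
    · obtain ⟨m, rfl⟩ := Nat.exists_eq_add_of_le' (show 2 ≤ m by have := h3 hp3; omega)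
      have hp3' : (p : ZMod M) = 3 := by exact_mod_cast congrArg (Nat.cast : ℕ → ZMod M) hp3
      rw [hp3'] at hM0 ⊢
      have hM1 : (3 : ZMod M) ^ (4 * m + 6) = 0 := by
        rw [show 4 * m + 6 = 3 * (m + 2) + m by ring, pow_add, hM0, zero_mul]
      refine ⟨θ * (3 ^ (m + 2) * u), 3 * (θ * (3 ^ (m + 1) * u)) ^ 2, θ * (3 ^ (m + 1) * u),
        ?_, ?_, ?_, ?_, ?_⟩
      · rw [← mul_assoc, hθ, one_mul]
      · ring
      · ring
      · linear_combination (θ * u) ^ 4 * hM1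
      · linear_combination (θ * u) ^ 3 * hM0
    · obtain ⟨η, hη⟩ : ∃ η : ZMod M, 3 * η = 1 := ⟨_, by
        have := ZMod.coe_mul_inv_eq_one (n := M) 3 (Nat.Coprime.pow_right _
          ((Nat.coprime_primes Nat.prime_three hp).2 (Ne.symm hp3)))
        exact_mod_cast this⟩
      refine ⟨θ * (p ^ m * u), η * (θ * (p ^ m * u)) ^ 2, η * (θ * (p ^ m * u)), ?_, ?_, ?_, ?_, ?_⟩
      · rw [← mul_assoc, hθ, one_mul]
      · rw [← mul_assoc 3, hη, one_mul]
      · rw [← mul_assoc 3, hη, one_mul]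
      · rw [pow_mul'] at hM0
        linear_combination η ^ 2 * (θ * u) ^ 4 * p ^ m * hM0
      · rw [pow_mul'] at hM0
        linear_combination 3 * η * (θ * u) ^ 3 * hM0
  obtain ⟨Γ, hΓ, a, b, c, habc, ha, hn⟩ := OddModel.exists_macdonaldTriple e0 e1 e2 e3
    ZMod.exists_cube_sub_eq_three_mul (α := α) (A := A) hM (ZMod.natCast_self M) hA
    (by rw [hAM, e])
  refine ⟨Γ, hΓ, a, b, c, habc, ha, fun h => ?_⟩
  have := hn _ h
  rw [ZMod.natCast_eq_zero_iff, hMdef] at this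
  have := (Nat.pow_dvd_pow_iff_le_right hp.one_lt).1 this
  omega

theorem exists_macdonaldTriple_pow_ne_one {p m : ℕ} (hp : p.Prime) (hm : m ≠ 0) {α u : ℤ}
    (hα : α = 1 + p ^ m * u) (hu : ¬ (p : ℤ) ∣ u) :
    ∃ (Γ : Type) (_ : Group Γ) (a b c : Γ), MacdonaldTriple α a b c ∧
      (∃ n, a ^ p ^ n = 1) ∧ a ^ p ^ (macdonaldExp p m α + m - 1) ≠ 1 := by
  unfold macdonaldExp
  by_cases h2 : p = 2
  · subst h2
    rw [if_pos rfl]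
    rcases Nat.lt_or_ge 1 m with h1 | h1
    · obtain ⟨Γ, hΓ, a, b, c, h, ha, ha'⟩ := exists_macdonaldTriple_of_two h1 hα
      refine ⟨Γ, hΓ, a, b, c, h, ⟨_, ha⟩, ?_⟩
      rwa [show 2 * m - 1 + m - 1 = 3 * m - 2 by omega]
    · obtain rfl : m = 1 := by omega
      obtain ⟨Γ, hΓ, a, b, c, h, ha, ha'⟩ := exists_macdonaldTriple_quaternion (α := α)
        (by push_cast at hα hu; omega)
      exact ⟨Γ, hΓ, a, b, c, h, ⟨2, ha⟩, ha'⟩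
  rw [if_neg h2]
  by_cases h3 : p = 3 ∧ m = 1
  · obtain ⟨rfl, rfl⟩ := h3
    by_cases h7 : α % 9 = 7
    · rw [if_pos ⟨rfl, h7⟩]
      obtain ⟨Γ, hΓ, a, b, c, h, ha, ha'⟩ := exists_macdonaldTriple_of_mod_nine_eq_seven h7
      exact ⟨Γ, hΓ, a, b, c, h, ⟨_, ha⟩, ha'⟩
    · rw [if_neg fun h => h7 h.2]
      obtain ⟨Γ, hΓ, a, b, c, h, ha, ha'⟩ := exists_macdonaldTriple_of_mod_nine_eq_four (α := α)
        (by push_cast at hα hu; omega)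
      exact ⟨Γ, hΓ, a, b, c, h, ⟨_, ha⟩, ha'⟩
  · obtain ⟨Γ, hΓ, a, b, c, h, ha, ha'⟩ := exists_macdonaldTriple_of_odd hp h2 hm
      (fun h h' => h3 ⟨h, h'⟩) hα
    refine ⟨Γ, hΓ, a, b, c, h, ⟨_, ha⟩, ?_⟩
    rw [if_neg]
    · rwa [show 2 * m + m - 1 = 3 * m - 1 by omega]
    · rintro ⟨rfl, h7⟩
      obtain ⟨m, rfl⟩ := Nat.exists_eq_add_of_le' (show 2 ≤ m by omega)
      rw [pow_add] at hα
      push_cast at hα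
      generalize hv : (3 : ℤ) ^ m * u = v
      have : α = 1 + 9 * v := by rw [hα, ← hv]; ring
      omega

/-! ### Both bounds combined. -/

theorem macdonaldExp_ne_zero {p m : ℕ} (hm : m ≠ 0) (α : ℤ) : macdonaldExp p m α ≠ 0 := by
  unfold macdonaldExp
  split_ifs <;> omega

namespace MacdonaldTriple

variable {H : Type*} [Group H] {α : ℤ} {a b c : H}

/-- At n = `orderOf a`, `conj_pow` puts c^n in ⟨a⟩, so c has finite order and the normal form leaves
finitely many elements. -/
theorem finite (h : MacdonaldTriple α a b c) (ha : IsOfFinOrder a) (hb : IsOfFinOrder b)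
    (hgood : ∀ x : H, ∃ i l j : ℤ, x = a ^ i * c ^ l * b ^ j) : Finite H := by
  have hc : IsOfFinOrder c := by
    have h1 := h.conj_pow (orderOf a)
    rw [pow_orderOf_eq_one, mul_one, inv_mul_cancel] at h1
    refine IsOfFinOrder.of_pow (n := orderOf a) ?_ ha.orderOf_pos.ne'
    rw [eq_inv_of_mul_eq_one_left h1.symm]
    exact ha.zpow.inv
  have := ha.finite_zpowers.to_subtype
  have := hb.finite_zpowers.to_subtype
  have := hc.finite_zpowers.to_subtype
  refine Finite.of_surjective
    (fun y : Subgroup.zpowers a × Subgroup.zpowers c × Subgroup.zpowers b =>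
      (y.1 * y.2.1 * y.2.2 : H)) fun x => ?_
  obtain ⟨i, l, j, rfl⟩ := hgood x
  exact ⟨⟨⟨_, i, rfl⟩, ⟨_, l, rfl⟩, ⟨_, j, rfl⟩⟩, rfl⟩

theorem pow_macdonaldExp_mem_zpowers (h : MacdonaldTriple α a b c) {p m n : ℕ} (hp : p.Prime)
    (hm : m ≠ 0) {u : ℤ} (hα : α = 1 + p ^ m * u) (hu : ¬ (p : ℤ) ∣ u) (ha : a ^ p ^ n = 1)
    (hb : b ^ p ^ n = 1) : a ^ p ^ macdonaldExp p m α ∈ Subgroup.zpowers b := by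
  -- Agreement modulo p^(m+n+2) ensures that the positive parameter has the same m, the same u
  -- modulo p and, if p = 3, the same residue modulo 9.
  have hN : ∀ {x : H}, x ^ p ^ n = 1 → x ^ p ^ (m + (n + 2)) = 1 := fun {x} hx => by
    rw [show m + (n + 2) = n + (m + 2) by ring, pow_add, pow_mul, hx, one_pow]
  obtain ⟨A, -, ⟨w, hw⟩, hA⟩ := h.exists_natCast (pow_pos hp.pos _) (hN ha) (hN hb)
  have hAu : (A : ℤ) = 1 + p ^ m * (u + p ^ (n + 2) * w) := by
    push_cast at hw
    linear_combination hw + hα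
  have hexp : macdonaldExp p m A = macdonaldExp p m α := by
    unfold macdonaldExp
    split_ifs with h1 h2 h3 h3
    · rfl
    · rfl
    · exact absurd ⟨h2.1, by
        have : (9 : ℤ) ∣ A - α := by
          rw [hw, h2.1]
          exact ⟨3 ^ (m + n) * w, by push_cast; ring⟩
        omega⟩ h3
    · exact absurd ⟨h3.1, by
        have : (9 : ℤ) ∣ A - α := by
          rw [hw, h3.1]
          exact ⟨3 ^ (m + n) * w, by push_cast; ring⟩
        omega⟩ h2
    · rfl
  obtain ⟨k, hk⟩ := exists_not_pow_dvd_geom_sub hp hm hAu fun hdvd => hu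
    ((dvd_add_left ((dvd_pow_self _ (by omega)).mul_right _)).1 hdvd)
  rw [hexp] at hk
  exact (Subgroup.zpowers_le.2 (hA.zpow_mem_zpowers (r := k) (s := A ^ k) (by push_cast; rfl)))
    (pow_mem_zpowers_zpow hp ha (e := macdonaldExp p m α + 1) (by exact_mod_cast hk))

end MacdonaldTriple

theorem four_dvd_sub_one {p m : ℕ} (h : ¬ (p = 2 ∧ m = 1)) (hm : m ≠ 0) {α u : ℤ}
    (hα : α = 1 + p ^ m * u) (h2 : p = 2) : (4 : ℤ) ∣ α - 1 := by
  subst h2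
  obtain ⟨m, rfl⟩ := Nat.exists_eq_add_of_le' (show 2 ≤ m by omega)
  exact ⟨2 ^ m * u, by rw [hα]; push_cast; ring⟩

theorem prime_dvd_of_prime_of_dvd_pow {p k : ℕ} (hp : p.Prime) {t : ℤ} (hpt : (p : ℤ) ∣ t) :
    ∀ q : ℕ, q.Prime → q ∣ p ^ k → (q : ℤ) ∣ t := fun q hq hqp => by
  rwa [(Nat.prime_dvd_prime_iff_eq hq hp).1 (hq.dvd_of_dvd_pow hqp)]

theorem pow_macdonaldExp_dvd_geom_sub {p m : ℕ} (hp : p.Prime) (hm : m ≠ 0) {α u : ℤ}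
    (hα : α = 1 + p ^ m * u) :
    ((p ^ macdonaldExp p m α : ℕ) : ℤ) ∣ MacdonaldTriple.geom α (p ^ (macdonaldExp p m α - 1)) -
      (p ^ (macdonaldExp p m α - 1) : ℕ) := by
  have hpt : (p : ℤ) ∣ α - 1 := by
    rw [hα, add_sub_cancel_left]; exact (dvd_pow_self _ hm).mul_right _
  by_cases h : p = 2 ∧ m = 1
  · obtain ⟨rfl, rfl⟩ := h
    simpa [macdonaldExp, MacdonaldTriple.geom] using hpt
  · have := MacdonaldTriple.geom_sub_dvd (k := p ^ (macdonaldExp p m α - 1)) hp hpt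
      (four_dvd_sub_one h hm hα) (prime_dvd_of_prime_of_dvd_pow hp hpt)
    rwa [mul_pow_sub_one (macdonaldExp_ne_zero hm α)] at this

/-- Lifting the exponent. It is unavailable for p = 2 and m = 1, but there e = 1 and no power is
taken. -/
theorem exists_pow_sub_one_eq {p m : ℕ} (hp : p.Prime) (hm : m ≠ 0) {α u : ℤ}
    (hα : α = 1 + p ^ m * u) (hu : ¬ (p : ℤ) ∣ u) : ∃ w : ℤ, ¬ (p : ℤ) ∣ w ∧
      α ^ p ^ (macdonaldExp p m α - 1) - 1 = (p : ℤ) ^ (macdonaldExp p m α + m - 1) * w := by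
  by_cases h : p = 2 ∧ m = 1
  · obtain ⟨rfl, rfl⟩ := h
    exact ⟨u, hu, by simp [macdonaldExp, hα]⟩
  have hpt : (p : ℤ) ∣ α - 1 := by
    rw [hα, add_sub_cancel_left]; exact (dvd_pow_self _ hm).mul_right _
  obtain ⟨v, hv⟩ := geom_sum_eq_mul hp hpt (four_dvd_sub_one h hm hα)
    (p ^ (macdonaldExp p m α - 1)) (prime_dvd_of_prime_of_dvd_pow hp hpt) α dvd_rfl
  refine ⟨u * (1 + p * v), fun hdvd => ?_, ?_⟩
  · rcases (Nat.prime_iff_prime_int.1 hp).dvd_or_dvd hdvd with h1 | h1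
    · exact hu h1
    · exact (Nat.prime_iff_prime_int.1 hp).not_dvd_one ((dvd_add_left (dvd_mul_right _ _)).1 h1)
  · have := macdonaldExp_ne_zero (p := p) hm α
    rw [← mul_geom_sum, hv, show macdonaldExp p m α + m - 1 = m + (macdonaldExp p m α - 1) by omega,
      pow_add]
    push_cast
    rw [show α - 1 = p ^ m * u by rw [hα]; ring]
    ring

theorem zpow_ne_self {H : Type*} [Group H] {a : H} {p m n : ℕ} (hp : p.Prime) (hm : m ≠ 0)
    {α u : ℤ} (hα : α = 1 + p ^ m * u) (hu : ¬ (p : ℤ) ∣ u) (ha : a ^ p ^ n = 1)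
    (hne : a ^ p ^ (macdonaldExp p m α + m - 1) ≠ 1) :
    a ^ (α ^ p ^ (macdonaldExp p m α - 1)) ≠ a := by
  intro h
  obtain ⟨w, hw, hαw⟩ := exists_pow_sub_one_eq hp hm hα hu
  refine hne (eq_one_of_pow_eq_one_of_coprime (m := w.natAbs) (n := p ^ n) ?_ ?_ ?_)
  · refine Nat.Coprime.pow_right _ (Nat.Coprime.symm ((Nat.Prime.coprime_iff_not_dvd hp).2 ?_))
    rwa [← Int.natCast_dvd]
  · have h1 : a ^ ((p : ℤ) ^ (macdonaldExp p m α + m - 1) * w) = 1 := by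
      rw [← hαw, zpow_sub, h, zpow_one, mul_inv_cancel]
    rw [zpow_mul] at h1
    rw [pow_natAbs_eq_one]
    exact_mod_cast h1
  · rw [← pow_mul, mul_comm, pow_mul, ha, one_pow]

theorem MacdonaldTriple.centralizer_eq_and_normalizer_eq {H : Type*} [Group H] [Finite H]
    {α : ℤ} {a b c : H} (h : MacdonaldTriple α a b c) {p m : ℕ} (hp : p.Prime)
    (hgood : ∀ x : H, ∃ i l j : ℤ, x = a ^ i * c ^ l * b ^ j) (hH : IsPGroup p H)
    (hm : m ≠ 0) {u : ℤ} (hα : α = 1 + p ^ m * u) (hu : ¬ (p : ℤ) ∣ u)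
    (hne : a ^ p ^ (macdonaldExp p m α + m - 1) ≠ 1) :
    Subgroup.centralizer {a} = Subgroup.zpowers a ∧
      Subgroup.normalizer (Subgroup.zpowers a : Set H) = Subgroup.closure {a, c} := by
  have hpt : (p : ℤ) ∣ α - 1 := by
    rw [hα, add_sub_cancel_left]; exact (dvd_pow_self _ hm).mul_right _
  have : Fact p.Prime := ⟨hp⟩
  obtain ⟨n, hn⟩ := hH.exists_card_eq
  have hpow : ∀ x : H, x ^ p ^ n = 1 := fun x => hn ▸ pow_card_eq_one'
  have ha := h.pow_macdonaldExp_mem_zpowers hp hm hα hu (hpow a) (hpow b)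
  have hb := h.swap.pow_macdonaldExp_mem_zpowers hp hm hα hu (hpow b) (hpow a)
  have he := macdonaldExp_ne_zero (p := p) hm α
  have hgeom := pow_macdonaldExp_dvd_geom_sub hp hm hα
  have hne' := zpow_ne_self hp hm hα hu (hpow a) hne
  exact ⟨h.centralizer_eq_zpowers hp hgood hH hpt ha hb he hgeom hne',
    h.normalizer_zpowers_eq hp hgood hH hpt hb he hgeom hne'⟩

/-! ### The presented group and its Sylow subgroup. -/

namespace MacdonaldGroup

theorem macdonaldTriple (α : ℤ) : MacdonaldTriple α (genA α) (genB α)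
    ((genA α)⁻¹ * (genB α)⁻¹ * genA α * genB α) := by
  have h1 := PresentedGroup.one_of_mem (rels := macdonaldRels α) (Set.mem_insert _ _)
  have h2 := PresentedGroup.one_of_mem (rels := macdonaldRels α) (Set.mem_insert_of_mem _ rfl)
  simp only [map_mul, map_inv, map_zpow] at h1 h2
  refine ⟨by group, mul_inv_eq_one.1 h1, ?_⟩
  have h3 := mul_inv_eq_one.1 h2
  refine Eq.trans ?_ h3
  simp only [genA, genB, PresentedGroup.of]
  group

theorem closure_eq_top (α : ℤ) : Subgroup.closure {genA α, genB α} = ⊤ := by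
  rw [← PresentedGroup.closure_range_of (macdonaldRels α)]
  congr 1
  ext x
  simp [Fin.exists_fin_two, genA, genB, eq_comm]

theorem exists_monoidHom {Γ : Type*} [Group Γ] {α : ℤ} {x y z : Γ} (h : MacdonaldTriple α x y z) :
    ∃ φ : MacdonaldGroup α →* Γ, φ (genA α) = x ∧ φ (genB α) = y := by
  have hrel : ∀ r ∈ macdonaldRels α, FreeGroup.lift ![x, y] r = 1 := by
    have hz := h.comm_eq
    rintro r (rfl | rfl)
    · simp only [map_mul, map_inv, map_zpow, FreeGroup.lift_apply_of, Matrix.cons_val_zero,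
        Matrix.cons_val_one]
      rw [← hz, h.conj_left, mul_inv_cancel]
    · simp only [map_mul, map_inv, map_zpow, FreeGroup.lift_apply_of, Matrix.cons_val_zero,
        Matrix.cons_val_one]
      rw [show y⁻¹ * x⁻¹ * y * x = z⁻¹ by rw [hz]; group, inv_inv, h.conj_right, mul_inv_cancel]
  exact ⟨PresentedGroup.toGroup hrel, PresentedGroup.toGroup.of hrel, PresentedGroup.toGroup.of hrel⟩

end MacdonaldGroup

/-- The kernel of π has order [G:J], prime to p. An element x^(p^k) in it has image under φ of order
both prime to p and a power of p, hence trivial. -/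
theorem pow_ne_one_of_isProjectionOnto {G Γ : Type*} [Group G] [Finite G] [Group Γ] {p : ℕ}
    [Fact p.Prime] {J : Sylow p G} {π : G →* (J : Subgroup G)}
    (hπ : IsProjectionOnto (J : Subgroup G) π) (φ : G →* Γ) {x : G} {n k : ℕ}
    (hx : φ x ^ p ^ n = 1) (hne : φ x ^ p ^ k ≠ 1) : π x ^ p ^ k ≠ 1 := by
  intro h
  have hsurj : Function.Surjective π := fun y => ⟨y, hπ y⟩
  have hcard : Nat.card π.ker = (J : Subgroup G).index := by
    have h1 := π.ker.card_mul_index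
    rw [Subgroup.index_ker, MonoidHom.range_eq_top.2 hsurj, Subgroup.card_top] at h1
    have h2 := (J : Subgroup G).index_mul_card
    exact Nat.eq_of_mul_eq_mul_right Nat.card_pos (h1.trans h2.symm)
  have h3 : (x ^ p ^ k) ^ (J : Subgroup G).index = 1 := by
    have hmem : x ^ p ^ k ∈ π.ker := by rw [MonoidHom.mem_ker, map_pow, h]
    rw [← hcard]
    exact congrArg Subtype.val (pow_card_eq_one' (x := (⟨_, hmem⟩ : π.ker)))
  refine hne (eq_one_of_pow_eq_one_of_coprime (m := p ^ n) (n := (J : Subgroup G).index) ?_ ?_ ?_)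
  · exact Nat.Coprime.pow_left _ ((Nat.Prime.coprime_iff_not_dvd Fact.out).2 J.not_dvd_index)
  · rw [← pow_mul, mul_comm, pow_mul, hx, one_pow]
  · rw [← map_pow, ← map_pow, h3, map_one]

theorem proposition7p3 (α : ℤ) (h0 : α ≠ 0) (h1 : α ≠ 1) (h2 : α ≠ 2)
    (p : ℕ) (hp : p.Prime) (hdvd : (p : ℤ) ∣ α - 1)
    (J : Sylow p (MacdonaldGroup α)) :
    (∃! π : MacdonaldGroup α →* (J : Subgroup (MacdonaldGroup α)),
      IsProjectionOnto (J : Subgroup (MacdonaldGroup α)) π) ∧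
    ∀ π : MacdonaldGroup α →* (J : Subgroup (MacdonaldGroup α)),
      IsProjectionOnto (J : Subgroup (MacdonaldGroup α)) π →
      ∀ A B C : (J : Subgroup (MacdonaldGroup α)),
        A = π (MacdonaldGroup.genA α) → B = π (MacdonaldGroup.genB α) →
        C = A⁻¹ * B⁻¹ * A * B →
        Subgroup.centralizer {A} = Subgroup.zpowers A ∧
        Subgroup.centralizer {B} = Subgroup.zpowers B ∧
        Subgroup.normalizer (Subgroup.zpowers A : Set (J : Subgroup (MacdonaldGroup α))) =
          Subgroup.closure {A, C} ∧
        Subgroup.normalizer (Subgroup.zpowers B : Set (J : Subgroup (MacdonaldGroup α))) =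
          Subgroup.closure {B, C} := by
  have : Fact p.Prime := ⟨hp⟩
  have h := MacdonaldGroup.macdonaldTriple α
  obtain ⟨hnil, hgood⟩ := h.isGood h0 h1 (MacdonaldGroup.closure_eq_top α)
  have hfin := h.finite (h.isOfFinOrder h0 h1) (h.swap.isOfFinOrder h0 h1) hgood
  refine ⟨existsUnique_isProjectionOnto J, ?_⟩
  rintro π hπ A B C rfl rfl hC
  have hJ := h.map π
  rw [show π ((MacdonaldGroup.genA α)⁻¹ * (MacdonaldGroup.genB α)⁻¹ * MacdonaldGroup.genA α *
    MacdonaldGroup.genB α) = C by simp [hC]] at hJ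
  have hgoodJ : ∀ x : (J : Subgroup (MacdonaldGroup α)), ∃ i l j : ℤ,
      x = π (MacdonaldGroup.genA α) ^ i * C ^ l * π (MacdonaldGroup.genB α) ^ j := fun x => by
    obtain ⟨i, l, j, hx⟩ := hgood x
    refine ⟨i, l, j, ?_⟩
    rw [← hπ x, hx, hC]
    simp only [map_mul, map_zpow, map_inv]
  have hgoodJ' : ∀ x : (J : Subgroup (MacdonaldGroup α)), ∃ i l j : ℤ,
      x = π (MacdonaldGroup.genB α) ^ i * C⁻¹ ^ l * π (MacdonaldGroup.genA α) ^ j := fun x => by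
    obtain ⟨i, l, j, hx⟩ := hgoodJ x⁻¹
    exact ⟨-j, l, -i, by rw [← inv_inv x, hx]; group⟩
  have hfinite : FiniteMultiplicity (p : ℤ) (α - 1) :=
    Int.finiteMultiplicity_iff.2 ⟨by simpa using hp.ne_one, sub_ne_zero.2 h1⟩
  obtain ⟨u, hαu, hu⟩ := hfinite.exists_eq_pow_mul_and_not_dvd
  set m := multiplicity (p : ℤ) (α - 1)
  have hm : m ≠ 0 := by
    intro hm
    rw [hm, pow_zero, one_mul] at hαu
    exact hu (hαu ▸ hdvd)
  have hα : α = 1 + p ^ m * u := by linear_combination hαu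
  obtain ⟨Γ, _, x, y, z, hΓ, ⟨n, hx⟩, hne⟩ := exists_macdonaldTriple_pow_ne_one hp hm hα hu
  obtain ⟨φ, hφA, -⟩ := MacdonaldGroup.exists_monoidHom hΓ
  -- The models bound the order of the first generator only; the swapped triple does it for b.
  obtain ⟨ψ, -, hψB⟩ := MacdonaldGroup.exists_monoidHom hΓ.swap
  obtain ⟨hA1, hA2⟩ := hJ.centralizer_eq_and_normalizer_eq hp hgoodJ J.isPGroup' hm hα hu
    (pow_ne_one_of_isProjectionOnto hπ φ (hφA ▸ hx) (hφA ▸ hne))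
  obtain ⟨hB1, hB2⟩ := hJ.swap.centralizer_eq_and_normalizer_eq hp hgoodJ' J.isPGroup' hm hα hu
    (pow_ne_one_of_isProjectionOnto hπ ψ (hψB ▸ hx) (hψB ▸ hne))
  -- The swapped triple yields the subgroup generated by B and C⁻¹.
  refine ⟨hA1, hB1, hA2, hB2.trans (le_antisymm ?_ ?_)⟩
  · rw [Subgroup.closure_le]
    rintro v (rfl | rfl)
    · exact Subgroup.subset_closure (by simp)
    · exact inv_mem (Subgroup.subset_closure (by simp))
  · rw [Subgroup.closure_le]
    rintro v (rfl | rfl)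
    · exact Subgroup.subset_closure (by simp)
    · exact inv_mem_iff.1 (Subgroup.subset_closure (by simp))
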